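/- Consider a restless bandit with finite state space $\{1,\dots,d\}$, transition matrices $\mathbf P^0,\mathbf P^1$ with rational entries and real rewards $R^a_i$ for action $a\in\{0,1\}$ ($1$ = activate, $0$ = passive) in state $i$. Suppose that it is aperiodic unichain: under every stationary policy $i\mapsto a(i)$ the chain with transition probabilities $P^{a(i)}_{ij}$ has exactly one closed class, and that class is aperiodic. Let $\alpha\in[0,1]$. For $N\ge 1$ take $N$ copies of this bandit; at time $t$ the copy $n$ is in state $S_n(t)$ and receives action $a_n(t)$, and given all states and actions the copies move independently, copy $n$ from $i$ to $j$ with probability $P^{a_n(t)}_{ij}$. The action vector $\mathbf a(t)$ is chosen by a (possibly randomized) stationary Markovian policy as a function of $\mathbf S(t)=(S_1(t),\dots,S_N(t))$. For a fixed initial state $\mathbf S(0)$ define $$V^{(N)}_{\mathrm{opt}}(\alpha)=\sup\ \lim_{T\to\infty}\frac1T\,\mathbb E\Big[\sum_{t=0}^{T-1}\sum_{n=1}^N R^{a_n(t)}_{S_n(t)}\Big]$$ over the policies that satisfy $\sum_{n=1}^N a_n(t)=\alpha N$ for all $t$ (when $\alpha N$ is an integer), and let $V^{(N)}_{\mathrm{rel}}(\alpha)$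 be the supremum of the same quantity over the policies that satisfy only $\lim_{T\to\infty}\frac1T\,\mathbb E\big[\sum_{t=0}^{T-1}\sum_{n=1}^N a_n(t)\big]=\alpha N$. Then, whatever the initial states, $$V^{(N)}_{\mathrm{rel}}(\alpha)=N\,V^{(1)}_{\mathrm{rel}}(\alpha)\quad\text{for all } N\ge 1,$$ and, as $N\to\infty$ along the integers $N$ such that $\alpha N$ is an integer, $V^{(N)}_{\mathrm{opt}}(\alpha)/N\to V^{(1)}_{\mathrm{rel}}(\alpha)$ at rate $O(1/\sqrt N)$: $$\limsup_{N\to\infty}\ \sqrt N\,\left|\frac{V^{(N)}_{\mathrm{opt}}(\alpha)}{N}-V^{(1)}_{\mathrm{rel}}(\alpha)\right|<\infty .$$ -/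

import Mathlib

open Filter Topology

namespace RestlessBandit

/-- A restless bandit with finite state space `S`: a stochastic transition matrix `P a` and a reward
vector `R a` for each of the two actions, `0` (passive) and `1` (active). -/
structure Bandit (S : Type*) [Fintype S] where
  P : Fin 2 → Matrix S S ℝ
  R : Fin 2 → S → ℝ
  P_nonneg : ∀ a i j, 0 ≤ P a i j
  P_sum : ∀ a i, ∑ j, P a i j = 1

/-- A closed (communicating) class of the finite Markov chain with transition matrix `M`. -/
def IsClosedClass {S : Type*} [Fintype S] [DecidableEq S] (M : Matrix S S ℝ) (C : Set S) : Prop :=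
  C.Nonempty ∧ (∀ i ∈ C, ∀ j, 0 < M i j → j ∈ C) ∧ ∀ i ∈ C, ∀ j ∈ C, ∃ n : ℕ, 0 < (M ^ n) i j

/-- The state `i` has period one: the only common divisor of the possible return times is `1`. -/
def IsAperiodicState {S : Type*} [Fintype S] [DecidableEq S] (M : Matrix S S ℝ) (i : S) : Prop :=
  ∀ k : ℕ, (∀ n : ℕ, 0 < n → 0 < (M ^ n) i i → k ∣ n) → k = 1

/-- The chain has exactly one closed class, and this class is aperiodic. States outside the class
(transient states) are allowed. -/
def IsAperiodicUnichainMatrix {S : Type*} [Fintype S] [DecidableEq S] (M : Matrix S S ℝ) : Prop :=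
  (∃! C : Set S, IsClosedClass M C) ∧
    ∀ C : Set S, IsClosedClass M C → ∀ i ∈ C, IsAperiodicState M i

/-- Transition matrix of one bandit that uses action `f i` whenever it is in state `i`. -/
def Bandit.policyMatrix {S : Type*} [Fintype S] (B : Bandit S) (f : S → Fin 2) : Matrix S S ℝ :=
  Matrix.of fun i j => B.P (f i) i j

/-- The bandit is aperiodic unichain: whichever policy is used, the induced chain has a single
closed class, which is aperiodic. -/
def Bandit.IsAperiodicUnichain {S : Type*} [Fintype S] [DecidableEq S] (B : Bandit S) : Prop :=
  ∀ f : S → Fin 2, IsAperiodicUnichainMatrix (B.policyMatrix f)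

/-- All entries of both transition matrices are rational. -/
def Bandit.IsRational {S : Type*} [Fintype S] (B : Bandit S) : Prop :=
  ∀ a i j, ∃ q : ℚ, B.P a i j = (q : ℝ)

/-- A (possibly randomized) Markovian stationary policy for `N` bandits: in the joint state `s`,
the action vector `a` is chosen with probability `prob s a`. -/
structure Policy (S : Type*) (N : ℕ) where
  prob : (Fin N → S) → (Fin N → Fin 2) → ℝ
  nonneg : ∀ s a, 0 ≤ prob s a
  sum_one : ∀ s, ∑ a, prob s a = 1

/-- The number of bandits that the action vector `a` activates, as a real number. -/
def numActive {N : ℕ} (a : Fin N → Fin 2) : ℝ := ∑ n, ((a n : ℕ) : ℝ)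

/-- Given the joint state and the action vector, the bandits move independently. -/
def Bandit.jointP {S : Type*} [Fintype S] (B : Bandit S) {N : ℕ}
    (s : Fin N → S) (a : Fin N → Fin 2) (s' : Fin N → S) : ℝ :=
  ∏ n, B.P (a n) (s n) (s' n)

/-- Total reward earned in one step. -/
def Bandit.reward {S : Type*} [Fintype S] (B : Bandit S) {N : ℕ}
    (s : Fin N → S) (a : Fin N → Fin 2) : ℝ :=
  ∑ n, B.R (a n) (s n)

/-- The law of the joint state at time `t` under the policy `π`, started in the state `s₀`. -/
def Bandit.law {S : Type*} [Fintype S] [DecidableEq S] (B : Bandit S) {N : ℕ}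
    (π : Policy S N) (s₀ : Fin N → S) : ℕ → (Fin N → S) → ℝ
  | 0 => fun s => if s = s₀ then 1 else 0
  | t + 1 => fun s' => ∑ s, ∑ a, B.law π s₀ t s * π.prob s a * B.jointP s a s'

/-- The expectation of `g (S(t), a(t))` under the policy `π`, started in the state `s₀`. -/
def Bandit.expect {S : Type*} [Fintype S] [DecidableEq S] (B : Bandit S) {N : ℕ}
    (π : Policy S N) (s₀ : Fin N → S) (t : ℕ) (g : (Fin N → S) → (Fin N → Fin 2) → ℝ) : ℝ :=
  ∑ s, ∑ a, B.law π s₀ t s * π.prob s a * g s a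

/-- `l` is the long-term expected average of `g (S(t), a(t))` under the policy `π`. -/
def Bandit.HasAverage {S : Type*} [Fintype S] [DecidableEq S] (B : Bandit S) {N : ℕ}
    (π : Policy S N) (s₀ : Fin N → S) (g : (Fin N → S) → (Fin N → Fin 2) → ℝ) (l : ℝ) : Prop :=
  Tendsto (fun T : ℕ => (1 / (T : ℝ)) * ∑ t ∈ Finset.range T, B.expect π s₀ t g) atTop (𝓝 l)

/-- The optimal value of the `N`-bandit problem started in `s₀`: at every decision epoch exactly
`α N` bandits are activated. -/
noncomputable def Bandit.optValue {S : Type*} [Fintype S] [DecidableEq S] (B : Bandit S) (α : ℝ)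
    (N : ℕ) (s₀ : Fin N → S) : ℝ :=
  sSup {v : ℝ | ∃ π : Policy S N,
    (∀ s a, 0 < π.prob s a → numActive a = α * N) ∧ B.HasAverage π s₀ B.reward v}

/-- The value of the relaxed `N`-bandit problem started in `s₀`: only the long-term average of the
number of activated bandits has to be `α N`. -/
noncomputable def Bandit.relValue {S : Type*} [Fintype S] [DecidableEq S] (B : Bandit S) (α : ℝ)
    (N : ℕ) (s₀ : Fin N → S) : ℝ :=
  sSup {v : ℝ | ∃ π : Policy S N,
    B.HasAverage π s₀ (fun _ a => numActive a) (α * N) ∧ B.HasAverage π s₀ B.reward v}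

/-- `N → ∞` along the integers `N` for which `α N` is an integer. -/
def atTopIntegral (α : ℝ) : Filter ℕ := atTop ⊓ 𝓟 {N : ℕ | ∃ K : ℕ, α * N = K}

end RestlessBandit

set_option linter.unusedSectionVars false
set_option linter.unusedVariables false

/-! Upper bound: under any policy that meets the activation budget on average, the long-run
state-action frequencies, averaged over the bandits, form a point of the compact convex set
`Bandit.feasible`. The reward is linear in this point, so the rate is at most `N` times the maximum
over that set (`OptimalMixture.le_value`). A maximiser splits into a stationary law `μ` and
activation probabilities `p`. Running `p` independently on each bandit attains the bound from every
initial state, because the chain `mixP p` satisfies Doeblin's condition. This settles the relaxed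
problem, and it bounds the constrained one above.

Lower bound, for `0 < α < 1`: a constrained policy that loses only `O(√N)` is built. In each joint
state, choose a largest set `D` of bandits whose deviation from `μ` is small compared with the
number `U` of bandits outside `D` (`controlled`, `uncontrolled`). The bandits of `D` follow `p` up
to rounding, and those outside absorb whatever activations remain (`exists_action`). In a norm
contracted by `mixP p` the deviation of `D` shrinks in one step, up to rounding and sampling noise.
The slack allows `D` to grow, and if noise has used up the slack, `D` is thinned out. The result is
`E U' ≤ κ U + c √N` with `κ < 1` (`exists_uncontrolled_drift`).

With a solution `h` of the one-bandit Poisson equation, the loss per step is at most `c₁ + c₂ U`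
(`sum_sub_ge_of_follow`). The drift of a multiple of `U` cancels the term `c₂ U`, which leaves
`O(√N)` (`exists_policy_ge`). For `α = 0` or `α = 1`, `p` is constant and the independent policy
already meets the hard constraint. -/

namespace RestlessBandit

/-! ### Finite Markov chains: Poisson equation, Doeblin's condition, a contracted norm. -/

section Chain

variable {S : Type*} [Fintype S] [DecidableEq S]

open Matrix

lemma abs_mulVec_le_of_mem_rowStochastic {M : Matrix S S ℝ} (hM : M ∈ rowStochastic ℝ S)
    {f : S → ℝ} {c : ℝ} (hf : ∀ i, |f i| ≤ c) (i : S) : |(M *ᵥ f) i| ≤ c := by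
  calc |(M *ᵥ f) i| ≤ ∑ j, |M i j * f j| := Finset.abs_sum_le_sum_abs _ _
    _ ≤ ∑ j, M i j * c := by
        refine Finset.sum_le_sum fun j _ => ?_
        rw [abs_mul, abs_of_nonneg (nonneg_of_mem_rowStochastic hM)]
        exact mul_le_mul_of_nonneg_left (hf j) (nonneg_of_mem_rowStochastic hM)
    _ = c := by rw [← Finset.sum_mul, sum_row_of_mem_rowStochastic hM, one_mul]

/-- Every function is the sum of a harmonic function and of a coboundary. -/
theorem exists_harmonic_add_coboundary {M : Matrix S S ℝ} (hM : M ∈ rowStochastic ℝ S)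
    (f : S → ℝ) : ∃ u g : S → ℝ, M *ᵥ u = u ∧ f = u + (g - M *ᵥ g) := by
  let A : (S → ℝ) →ₗ[ℝ] (S → ℝ) := LinearMap.id - M.mulVecLin
  have hA : ∀ x, A x = x - M *ᵥ x := fun x => by simp [A]
  have hdisj : Disjoint (LinearMap.ker A) (LinearMap.range A) := by
    rw [Submodule.disjoint_def]
    rintro x hx ⟨y, rfl⟩
    rw [LinearMap.mem_ker] at hx
    set x := A y with hxdef
    have hMx : M *ᵥ x = x := by
      have := hA x
      rw [hx] at this
      exact (sub_eq_zero.mp this.symm).symm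
    -- If `x = y - M y` is harmonic, the iterates of `y` drift linearly along `x`, yet they stay
    -- bounded, so `x = 0`.
    have hpow : ∀ n : ℕ, (M ^ n) *ᵥ y = y - (n : ℝ) • x := by
      intro n
      induction n with
      | zero => simp
      | succ n ih =>
        rw [pow_succ', ← mulVec_mulVec, ih, mulVec_sub, mulVec_smul, hMx]
        have h1 : M *ᵥ y = y - x := by rw [hxdef, hA]; abel
        rw [h1]; push_cast; rw [add_smul, one_smul]; abel
    obtain ⟨c, hc⟩ : ∃ c, ∀ i, |y i| ≤ c :=
      ⟨‖y‖, fun i => by simpa using norm_le_pi_norm y i⟩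
    funext i
    by_contra hne
    have hpos : 0 < |x i| := abs_pos.mpr hne
    obtain ⟨n, hn⟩ := exists_nat_gt (2 * c / |x i|)
    rw [div_lt_iff₀ hpos] at hn
    have h1 := abs_mulVec_le_of_mem_rowStochastic (pow_mem hM n) hc i
    rw [hpow n] at h1
    have h2 : (n : ℝ) * |x i| = |y i - (y - (n : ℝ) • x) i| := by
      simp [abs_mul]
    have h3 := abs_sub (y i) ((y - (n : ℝ) • x) i)
    linarith [hc i]
  have hsup : LinearMap.ker A ⊔ LinearMap.range A = ⊤ := by
    apply Submodule.eq_top_of_disjoint _ _ _ hdisj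
    rw [add_comm, LinearMap.finrank_range_add_finrank_ker]
  obtain ⟨u, hu, v, ⟨g, rfl⟩, huv⟩ := Submodule.mem_sup.mp (hsup ▸ Submodule.mem_top : f ∈ _)
  refine ⟨u, g, ?_, by rw [← huv, hA]⟩
  rw [LinearMap.mem_ker, hA, sub_eq_zero] at hu
  exact hu.symm

lemma pow_mul_pow_le_pow_add {M : Matrix S S ℝ} (hM : ∀ i j, 0 ≤ M i j) (m n : ℕ) (i j k : S) :
    (M ^ m) i j * (M ^ n) j k ≤ (M ^ (m + n)) i k := by
  rw [pow_add, mul_apply]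
  have hp : ∀ (n : ℕ) i j, 0 ≤ (M ^ n) i j := by
    intro n
    induction n with
    | zero => intro i j; simp only [pow_zero, one_apply]; split_ifs <;> norm_num
    | succ n ih =>
      intro i j
      rw [pow_succ, mul_apply]
      exact Finset.sum_nonneg fun k _ => mul_nonneg (ih _ _) (hM _ _)
  exact Finset.single_le_sum (f := fun j => (M ^ m) i j * (M ^ n) j k)
    (fun j _ => mul_nonneg (hp _ _ _) (hp _ _ _)) (Finset.mem_univ j)

lemma pow_add_pos {M : Matrix S S ℝ} (hM : ∀ i j, 0 ≤ M i j) {m n : ℕ} {i j k : S}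
    (h₁ : 0 < (M ^ m) i j) (h₂ : 0 < (M ^ n) j k) : 0 < (M ^ (m + n)) i k :=
  (mul_pos h₁ h₂).trans_le (pow_mul_pow_le_pow_add hM m n i j k)

/-- The states that can be reached from `i`. -/
def reachable (M : Matrix S S ℝ) (i : S) : Set S := {j | ∃ n : ℕ, 0 < (M ^ n) i j}

lemma mem_reachable_self (M : Matrix S S ℝ) (i : S) : i ∈ reachable M i := ⟨0, by simp⟩

lemma reachable_subset {M : Matrix S S ℝ} (hM : ∀ i j, 0 ≤ M i j) {i j : S}
    (h : j ∈ reachable M i) : reachable M j ⊆ reachable M i := by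
  obtain ⟨m, hm⟩ := h
  rintro k ⟨n, hn⟩
  exact ⟨m + n, pow_add_pos hM hm hn⟩

/-- A reachable set of least cardinality works: each of its states reaches a subset of it, hence all
of it by minimality. -/
lemma exists_isClosedClass_subset_reachable {M : Matrix S S ℝ} (hM : ∀ i j, 0 ≤ M i j) (i : S) :
    ∃ C, IsClosedClass M C ∧ C ⊆ reachable M i := by
  obtain ⟨k, hk, hmin⟩ := Set.exists_min_image (reachable M i) (fun k => (reachable M k).ncard)
    (Set.toFinite _) ⟨i, mem_reachable_self M i⟩
  refine ⟨reachable M k, ⟨⟨k, mem_reachable_self M k⟩, ?_, ?_⟩, reachable_subset hM hk⟩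
  · rintro j ⟨n, hn⟩ l hl
    exact ⟨n + 1, pow_add_pos hM hn (by simpa using hl)⟩
  · intro j hj l hl
    have hsub := reachable_subset hM hj
    have : reachable M j = reachable M k :=
      Set.eq_of_subset_of_ncard_le hsub (hmin j (reachable_subset hM hk hj)) (Set.toFinite _)
    rw [← this] at hl
    exact hl

/-- An aperiodic unichain matrix satisfies Doeblin's condition. -/
theorem IsAperiodicUnichainMatrix.exists_pow_pos {M : Matrix S S ℝ} (hM : ∀ i j, 0 ≤ M i j)
    (h : IsAperiodicUnichainMatrix M) : ∃ (K : ℕ) (j : S), ∀ i, 0 < (M ^ K) i j := by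
  obtain ⟨⟨C, hC, huniq⟩, haper⟩ := h
  obtain ⟨j, hj⟩ := hC.1
  have hreach : ∀ i, ∃ n : ℕ, 0 < (M ^ n) i j := by
    intro i
    obtain ⟨C', hC', hsub⟩ := exists_isClosedClass_subset_reachable hM i
    rw [huniq C' hC'] at hsub
    exact hsub hj
  choose n hn using hreach
  let R : Set ℕ := {m | 0 < (M ^ m) j j}
  have hgcd : Nat.setGcd R = 1 := haper C hC j hj _ fun m _ hm => Nat.setGcd_dvd_of_mem hm
  obtain ⟨m₀, hm₀⟩ := Nat.exists_mem_closure_of_ge R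
  have hclos : ∀ m ∈ AddSubmonoid.closure R, 0 < (M ^ m) j j := by
    intro m hm
    induction hm using AddSubmonoid.closure_induction with
    | mem x hx => exact hx
    | zero => simp
    | add x y _ _ hx hy => exact pow_add_pos hM hx hy
  -- One exponent serves every `i`: after the `n i` steps to `j` at least `m₀` steps remain, and
  -- since the return times to `j` have gcd one, every such number of steps can be spent on loops at
  -- `j`.
  refine ⟨∑ i, n i + m₀, j, fun i => ?_⟩
  have hle : n i ≤ ∑ i, n i := Finset.single_le_sum (fun _ _ => Nat.zero_le _) (Finset.mem_univ i)
  have : ∑ i, n i + m₀ = n i + (∑ i, n i + m₀ - n i) := by omega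
  rw [this]
  exact pow_add_pos hM (hn i) (hclos _ (hm₀ _ (by omega) (by simp [hgcd])))

/-- Doeblin's condition passes to matrices with a larger support. -/
lemma pow_pos_of_support_le {M M' : Matrix S S ℝ} (hM : ∀ i j, 0 ≤ M i j) (hM' : ∀ i j, 0 ≤ M' i j)
    (h : ∀ i j, 0 < M i j → 0 < M' i j) (n : ℕ) (i j : S) (hp : 0 < (M ^ n) i j) :
    0 < (M' ^ n) i j := by
  induction n generalizing j with
  | zero => simpa using hp
  | succ n ih =>
    rw [pow_succ, mul_apply] at hp
    obtain ⟨k, -, hk⟩ := Finset.exists_lt_of_sum_lt (s := Finset.univ) (f := fun _ : S => (0 : ℝ))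
      (by simpa using hp)
    have h1 : 0 < M k j := by
      rcases (hM k j).lt_or_eq with h | h
      · exact h
      · simp [← h] at hk
    have h2 : 0 < (M ^ n) i k := pos_of_mul_pos_left hk (hM k j)
    exact pow_add_pos hM' (ih k h2) (by simpa using h k j h1)

/-- Total variation contraction of a row-stochastic matrix with a positive column. -/
theorem exists_contraction_of_column_pos {M : Matrix S S ℝ} (hM : M ∈ rowStochastic ℝ S) {j : S}
    (hj : ∀ i, 0 < M i j) : ∃ ε : ℝ, 0 < ε ∧ ε ≤ 1 ∧
      ∀ y : S → ℝ, ∑ i, y i = 0 → ∑ k, |(y ᵥ* M) k| ≤ (1 - ε) * ∑ i, |y i| := by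
  obtain ⟨i₀, -, hmin⟩ := Finset.exists_min_image Finset.univ (fun i => M i j) ⟨j, Finset.mem_univ j⟩
  refine ⟨M i₀ j, hj i₀, le_one_of_mem_rowStochastic hM, fun y hy => ?_⟩
  set ε := M i₀ j
  -- Every row puts mass at least `ε` on `j`. Removing this common mass does not change the action
  -- on vectors of total mass zero, and it leaves a nonnegative kernel with row sums `1 - ε`.
  let Q : S → S → ℝ := fun i k => M i k - if k = j then ε else 0
  have hQ : ∀ i k, 0 ≤ Q i k := by
    intro i k
    simp only [Q]
    split_ifs with h
    · subst h; linarith [hmin i (Finset.mem_univ i)]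
    · simpa using nonneg_of_mem_rowStochastic hM
  have hQsum : ∀ i, ∑ k, Q i k = 1 - ε := by
    intro i
    simp [Q, Finset.sum_sub_distrib, sum_row_of_mem_rowStochastic hM]
  have hyQ : ∀ k, (y ᵥ* M) k = ∑ i, y i * Q i k := by
    intro k
    simp only [vecMul, dotProduct, Q, mul_sub, Finset.sum_sub_distrib, ← Finset.sum_mul, hy]
    simp
  calc ∑ k, |(y ᵥ* M) k| ≤ ∑ k, ∑ i, |y i| * Q i k := by
        refine Finset.sum_le_sum fun k _ => ?_
        rw [hyQ]
        refine (Finset.abs_sum_le_sum_abs _ _).trans (Finset.sum_le_sum fun i _ => ?_)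
        rw [abs_mul, abs_of_nonneg (hQ i k)]
    _ = (1 - ε) * ∑ i, |y i| := by
        rw [Finset.sum_comm, Finset.mul_sum]
        refine Finset.sum_congr rfl fun i _ => ?_
        rw [← Finset.mul_sum, hQsum, mul_comm]

lemma sum_vecMul_of_mem_rowStochastic {M : Matrix S S ℝ} (hM : M ∈ rowStochastic ℝ S)
    (y : S → ℝ) : ∑ k, (y ᵥ* M) k = ∑ i, y i := by
  simp only [vecMul, dotProduct]
  rw [Finset.sum_comm]
  simp [← Finset.mul_sum, sum_row_of_mem_rowStochastic hM]

lemma sum_abs_vecMul_le {M : Matrix S S ℝ} (hM : M ∈ rowStochastic ℝ S)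
    (y : S → ℝ) : ∑ k, |(y ᵥ* M) k| ≤ ∑ i, |y i| := by
  calc ∑ k, |(y ᵥ* M) k| ≤ ∑ k, ∑ i, |y i| * M i k := by
        refine Finset.sum_le_sum fun k _ => ?_
        refine (Finset.abs_sum_le_sum_abs _ _).trans (Finset.sum_le_sum fun i _ => ?_)
        rw [abs_mul, abs_of_nonneg (nonneg_of_mem_rowStochastic hM)]
    _ = ∑ i, |y i| := by
        rw [Finset.sum_comm]
        simp [← Finset.mul_sum, sum_row_of_mem_rowStochastic hM]

/-- Under Doeblin's condition, harmonic functions are constant. -/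
theorem harmonic_const {M : Matrix S S ℝ} (hM : M ∈ rowStochastic ℝ S) {K : ℕ} {j : S}
    (hj : ∀ i, 0 < (M ^ K) i j) {u : S → ℝ} (hu : M *ᵥ u = u) (i k : S) : u i = u k := by
  have hpow : (M ^ K) *ᵥ u = u := by
    clear hj
    induction K with
    | zero => simp
    | succ n ih => rw [pow_succ, ← mulVec_mulVec, hu, ih]
  obtain ⟨a, -, ha⟩ := Finset.exists_max_image Finset.univ u ⟨j, Finset.mem_univ j⟩
  obtain ⟨b, -, hb⟩ := Finset.exists_min_image Finset.univ u ⟨j, Finset.mem_univ j⟩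
  have hMK := pow_mem hM K
  -- Maximum principle: `u a` is an average of values at most `u a`, with positive weight on `j`, so
  -- the maximum is attained at `j`. The minimum is treated in the same way.
  have h1 : u a ≤ u j := by
    have h0 : ∑ k, (M ^ K) a k * (u a - u k) = 0 := by
      have := congrFun hpow a
      simp only [mulVec, dotProduct] at this
      simp only [mul_sub, Finset.sum_sub_distrib, ← Finset.sum_mul, this,
        sum_row_of_mem_rowStochastic hMK]
      ring
    rw [Finset.sum_eq_zero_iff_of_nonneg fun k _ =>
      mul_nonneg (nonneg_of_mem_rowStochastic hMK) (sub_nonneg.mpr (ha k (Finset.mem_univ k)))] at h0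
    have := h0 j (Finset.mem_univ j)
    rcases mul_eq_zero.mp this with h | h
    · exact absurd h (hj a).ne'
    · linarith
  have h2 : u j ≤ u b := by
    have h0 : ∑ k, (M ^ K) b k * (u k - u b) = 0 := by
      have := congrFun hpow b
      simp only [mulVec, dotProduct] at this
      simp only [mul_sub, Finset.sum_sub_distrib, ← Finset.sum_mul, this,
        sum_row_of_mem_rowStochastic hMK]
      ring
    rw [Finset.sum_eq_zero_iff_of_nonneg fun k _ =>
      mul_nonneg (nonneg_of_mem_rowStochastic hMK) (sub_nonneg.mpr (hb k (Finset.mem_univ k)))] at h0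
    have := h0 j (Finset.mem_univ j)
    rcases mul_eq_zero.mp this with h | h
    · exact absurd h (hj b).ne'
    · linarith
  linarith [ha i (Finset.mem_univ i), ha k (Finset.mem_univ k), hb i (Finset.mem_univ i),
    hb k (Finset.mem_univ k)]

/-- The Poisson equation under Doeblin's condition. -/
theorem exists_poisson {M : Matrix S S ℝ} (hM : M ∈ rowStochastic ℝ S) {K : ℕ} {j : S}
    (hj : ∀ i, 0 < (M ^ K) i j) {μ : S → ℝ} (hμ : μ ᵥ* M = μ) (hμ1 : ∑ i, μ i = 1) (f : S → ℝ) :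
    ∃ g : S → ℝ, ∀ i, f i = (∑ k, μ k * f k) + (g i - (M *ᵥ g) i) := by
  obtain ⟨u, g, hu, hf⟩ := exists_harmonic_add_coboundary hM f
  have hconst : ∀ i, u i = u j := fun i => harmonic_const hM hj hu i j
  -- Pairing with the stationary law kills the coboundary, which identifies the constant.
  have hmean : ∑ k, μ k * f k = u j := by
    have h1 : μ ⬝ᵥ (M *ᵥ g) = μ ⬝ᵥ g := by rw [dotProduct_mulVec, hμ]
    have h2 : μ ⬝ᵥ f = μ ⬝ᵥ u := by rw [hf, dotProduct_add, dotProduct_sub, h1]; ring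
    change μ ⬝ᵥ f = u j
    rw [h2]
    simp only [dotProduct, hconst, ← Finset.sum_mul, hμ1, one_mul]
  refine ⟨g, fun i => ?_⟩
  rw [hmean, ← hconst i]
  exact congrFun hf i

/-- A norm equivalent to the `ℓ¹` norm that `M` contracts at every step on the signed measures of
total mass zero. -/
structure ContractedNorm (M : Matrix S S ℝ) where
  toFun : (S → ℝ) → ℝ
  ρ : ℝ
  C : ℝ
  ρ_nonneg : 0 ≤ ρ
  ρ_lt_one : ρ < 1
  C_pos : 0 < C
  add_le : ∀ y z, toFun (y + z) ≤ toFun y + toFun z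
  smul : ∀ (c : ℝ) y, toFun (c • y) = |c| * toFun y
  sum_abs_le : ∀ y, ∑ i, |y i| ≤ toFun y
  le_sum_abs : ∀ y, toFun y ≤ C * ∑ i, |y i|
  vecMul_le : ∀ y, ∑ i, y i = 0 → toFun (y ᵥ* M) ≤ ρ * toFun y

/-- The norm sums the `ℓ¹` norms of `y M ^ k` for `0 ≤ k ≤ K`. Applying `M` trades the term `‖y‖₁`
for `‖y M ^ (K + 1)‖₁ ≤ (1 - ε) ‖y‖₁`, and the gain `ε ‖y‖₁` is at least the fraction `ε / (K + 1)`
of the whole sum. The term `k = 0` makes the norm dominate `ℓ¹`, even when `K = 0`. -/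
theorem nonempty_contractedNorm {M : Matrix S S ℝ} (hM : M ∈ rowStochastic ℝ S) {K : ℕ} {j : S}
    (hj : ∀ i, 0 < (M ^ K) i j) : Nonempty (ContractedNorm M) := by
  obtain ⟨ε, hε0, hε1, hcontr⟩ := exists_contraction_of_column_pos (pow_mem hM K) hj
  let N : (S → ℝ) → ℝ := fun y => ∑ i, |y i|
  have hN0 : ∀ y, 0 ≤ N y := fun y => Finset.sum_nonneg fun i _ => abs_nonneg _
  have hNle : ∀ k y, N (y ᵥ* M ^ k) ≤ N y := fun k y => sum_abs_vecMul_le (pow_mem hM k) y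
  let Φ : (S → ℝ) → ℝ := fun y => ∑ k ∈ Finset.range (K + 1), N (y ᵥ* M ^ k)
  have hNΦ : ∀ y, N y ≤ Φ y := fun y => by
    have := Finset.single_le_sum (f := fun k => N (y ᵥ* M ^ k)) (fun k _ => hN0 _)
      (Finset.mem_range.mpr (Nat.succ_pos K))
    simpa using this
  have hΦN : ∀ y, Φ y ≤ (K + 1) * N y := fun y => by
    have := Finset.sum_le_sum (s := Finset.range (K + 1)) fun k _ => hNle k y
    simpa using this
  have hK : (0 : ℝ) < K + 1 := by positivity
  refine ⟨⟨Φ, 1 - ε / (K + 1), K + 1, ?_, ?_, hK, ?_, ?_, hNΦ, hΦN, ?_⟩⟩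
  · rw [sub_nonneg, div_le_one hK]; linarith [(Nat.cast_nonneg K : (0 : ℝ) ≤ K)]
  · linarith [div_pos hε0 hK]
  · intro y z
    simp only [Φ, N, ← Finset.sum_add_distrib, add_vecMul]
    exact Finset.sum_le_sum fun k _ => Finset.sum_le_sum fun i _ => abs_add_le _ _
  · intro c y
    simp only [Φ, N, Finset.mul_sum, smul_vecMul, Pi.smul_apply, smul_eq_mul, abs_mul]
  · intro y hy
    have h1 : Φ (y ᵥ* M) + N y = Φ y + N (y ᵥ* M ^ (K + 1)) := by
      simp only [Φ, vecMul_vecMul, ← pow_succ']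
      have := Finset.sum_range_succ' (fun k => N (y ᵥ* M ^ k)) (K + 1)
      rw [Finset.sum_range_succ] at this
      simp only [pow_zero, vecMul_one] at this
      linarith
    have h2 : N (y ᵥ* M ^ (K + 1)) ≤ (1 - ε) * N y := by
      rw [pow_succ, ← vecMul_vecMul]
      exact (sum_abs_vecMul_le hM _).trans (hcontr y hy)
    have h3 : ε / (K + 1) * Φ y ≤ ε * N y := by
      rw [div_mul_eq_mul_div, div_le_iff₀ hK]
      nlinarith [mul_le_mul_of_nonneg_left (hΦN y) hε0.le]
    linarith

end Chain

/-! ### Means and fluctuations under product measures. -/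

section ProductWeights

variable {ι κ : Type*} [Fintype ι] [DecidableEq ι] [Fintype κ]

lemma sum_prod_weights_mul_prod (w g : ι → κ → ℝ) :
    ∑ x : ι → κ, (∏ n, w n (x n)) * ∏ n, g n (x n) = ∏ n, ∑ j, w n j * g n j := by
  rw [Finset.prod_univ_sum, Fintype.piFinset_univ]
  simp only [Finset.prod_mul_distrib]

lemma sum_prod_weights {w : ι → κ → ℝ} (hw : ∀ n, ∑ j, w n j = 1) :
    ∑ x : ι → κ, ∏ n, w n (x n) = 1 := by
  have := sum_prod_weights_mul_prod w fun _ _ => 1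
  simpa [hw] using this

lemma sum_prod_weights_mul_apply {w : ι → κ → ℝ} (hw : ∀ n, ∑ j, w n j = 1) (m : ι) (f : κ → ℝ) :
    ∑ x : ι → κ, (∏ n, w n (x n)) * f (x m) = ∑ j, w m j * f j := by
  have := sum_prod_weights_mul_prod w fun n j => if n = m then f j else 1
  have h1 : ∀ x : ι → κ, ∏ n, (if n = m then f (x n) else 1) = f (x m) := fun x => by
    rw [Finset.prod_ite_eq' Finset.univ m (fun n => f (x n))]; simp
  simp only [h1] at this
  rw [this, Finset.prod_eq_single m]
  · simp
  · intro n _ hn; simp [hn, hw]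
  · simp

lemma sum_prod_weights_mul_apply_mul_apply {w : ι → κ → ℝ} (hw : ∀ n, ∑ j, w n j = 1) {m m' : ι}
    (hm : m ≠ m') (f f' : κ → ℝ) :
    ∑ x : ι → κ, (∏ n, w n (x n)) * (f (x m) * f' (x m')) =
      (∑ j, w m j * f j) * ∑ j, w m' j * f' j := by
  have := sum_prod_weights_mul_prod w
    fun n j => (if n = m then f j else 1) * (if n = m' then f' j else 1)
  have h1 : ∀ x : ι → κ, ∏ n, ((if n = m then f (x n) else 1) * (if n = m' then f' (x n) else 1)) =
      f (x m) * f' (x m') := fun x => by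
    rw [Finset.prod_mul_distrib, Finset.prod_ite_eq' Finset.univ m (fun n => f (x n)),
      Finset.prod_ite_eq' Finset.univ m' (fun n => f' (x n))]
    simp
  simp only [h1] at this
  rw [this, Finset.prod_eq_mul m m' hm]
  · simp [hm, hm.symm]
  · intro n _ hn; simp [hn.1, hn.2, hw]
  · simp
  · simp

lemma sum_prod_weights_mul_sum {w : ι → κ → ℝ} (hw : ∀ n, ∑ j, w n j = 1) (D : Finset ι)
    (f : ι → κ → ℝ) :
    ∑ x : ι → κ, (∏ n, w n (x n)) * ∑ n ∈ D, f n (x n) = ∑ n ∈ D, ∑ j, w n j * f n j := by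
  simp only [Finset.mul_sum]
  rw [Finset.sum_comm]
  exact Finset.sum_congr rfl fun n _ => sum_prod_weights_mul_apply hw n (f n)

/-- The variance of a sum of independent centred variables bounded by one. -/
lemma sum_prod_weights_mul_sum_sq_le {w : ι → κ → ℝ} (hw0 : ∀ n j, 0 ≤ w n j)
    (hw : ∀ n, ∑ j, w n j = 1) (D : Finset ι) {f : ι → κ → ℝ}
    (hf : ∀ n, ∑ j, w n j * f n j = 0) (hf1 : ∀ n j, |f n j| ≤ 1) :
    ∑ x : ι → κ, (∏ n, w n (x n)) * (∑ n ∈ D, f n (x n)) ^ 2 ≤ D.card := by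
  have h1 : ∀ x : ι → κ, (∏ n, w n (x n)) * (∑ n ∈ D, f n (x n)) ^ 2 =
      ∑ m ∈ D, ∑ m' ∈ D, (∏ n, w n (x n)) * (f m (x m) * f m' (x m')) := fun x => by
    rw [sq, Finset.sum_mul_sum, Finset.mul_sum]
    simp only [Finset.mul_sum]
  simp only [h1]
  rw [Finset.sum_comm]
  have h2 : ∀ m ∈ D, ∑ x : ι → κ, ∑ m' ∈ D, (∏ n, w n (x n)) * (f m (x m) * f m' (x m')) ≤ 1 := by
    intro m hm
    rw [Finset.sum_comm, Finset.sum_eq_single_of_mem m hm]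
    · rw [sum_prod_weights_mul_apply hw m (fun j => f m j * f m j), ← hw m]
      refine Finset.sum_le_sum fun j _ => mul_le_of_le_one_right (hw0 m j) ?_
      rw [← sq, sq_le_one_iff_abs_le_one]
      exact hf1 m j
    · intro m' _ hne
      rw [sum_prod_weights_mul_apply_mul_apply hw hne.symm, hf, zero_mul]
  simpa using Finset.sum_le_sum h2

lemma sum_prod_weights_mul_abs_sum_le {w : ι → κ → ℝ} (hw0 : ∀ n j, 0 ≤ w n j)
    (hw : ∀ n, ∑ j, w n j = 1) (D : Finset ι) {f : ι → κ → ℝ}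
    (hf : ∀ n, ∑ j, w n j * f n j = 0) (hf1 : ∀ n j, |f n j| ≤ 1) :
    ∑ x : ι → κ, (∏ n, w n (x n)) * |∑ n ∈ D, f n (x n)| ≤ √(Fintype.card ι : ℝ) := by
  set c := √(Fintype.card ι : ℝ) with hc
  have hp : ∀ x : ι → κ, 0 ≤ ∏ n, w n (x n) := fun x => Finset.prod_nonneg fun n _ => hw0 n _
  rcases (Real.sqrt_nonneg (Fintype.card ι : ℝ)).eq_or_lt with h0 | hpos
  · have : IsEmpty ι := by
      rw [eq_comm, Real.sqrt_eq_zero (Nat.cast_nonneg _), Nat.cast_eq_zero,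
        Fintype.card_eq_zero_iff] at h0
      exact h0
    simp [Finset.eq_empty_of_isEmpty D, hc]
  rw [← hc] at hpos
  have hsq : c * c = Fintype.card ι := Real.mul_self_sqrt (Nat.cast_nonneg _)
  have hvar := sum_prod_weights_mul_sum_sq_le hw0 hw D hf hf1
  have hcard : (D.card : ℝ) ≤ Fintype.card ι := by exact_mod_cast D.card_le_univ
  -- This pointwise inequality, with `c` the target bound, replaces Cauchy–Schwarz in passing from
  -- the variance to the first moment.
  have hpt : ∀ z : ℝ, |z| ≤ z ^ 2 / (2 * c) + c / 2 := fun z => by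
    have : |z| = (2 * c * |z|) / (2 * c) := by field_simp
    rw [this, show z ^ 2 / (2 * c) + c / 2 = (z ^ 2 + c * c) / (2 * c) by field_simp]
    gcongr
    nlinarith [sq_nonneg (|z| - c), sq_abs z]
  calc ∑ x : ι → κ, (∏ n, w n (x n)) * |∑ n ∈ D, f n (x n)|
      ≤ ∑ x : ι → κ, ((∏ n, w n (x n)) * (∑ n ∈ D, f n (x n)) ^ 2 / (2 * c)
          + (∏ n, w n (x n)) * (c / 2)) := by
        refine Finset.sum_le_sum fun x _ => ?_
        rw [mul_div_assoc, ← mul_add]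
        exact mul_le_mul_of_nonneg_left (hpt _) (hp x)
    _ = (∑ x : ι → κ, (∏ n, w n (x n)) * (∑ n ∈ D, f n (x n)) ^ 2) / (2 * c) + c / 2 := by
        rw [Finset.sum_add_distrib, ← Finset.sum_div, ← Finset.sum_mul, sum_prod_weights hw, one_mul]
    _ ≤ (c * c) / (2 * c) + c / 2 := by rw [hsq]; gcongr; exact hvar.trans hcard
    _ = c := by field_simp; ring

end ProductWeights

/-! ### The joint chain and long-run averages by telescoping. -/

section Policies

open Matrix

variable {S : Type*} [Fintype S] [DecidableEq S] {N : ℕ}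

/-- The transition matrix of the joint state under a policy. -/
def Bandit.kernel (B : Bandit S) (π : Policy S N) : Matrix (Fin N → S) (Fin N → S) ℝ :=
  Matrix.of fun s s' => ∑ a, π.prob s a * B.jointP s a s'

/-- The mean of `g s a` over the action vector `a` chosen in the joint state `s`. -/
def Policy.mean (π : Policy S N) (g : (Fin N → S) → (Fin N → Fin 2) → ℝ) (s : Fin N → S) : ℝ :=
  ∑ a, π.prob s a * g s a

lemma Bandit.jointP_nonneg (B : Bandit S) (s : Fin N → S) (a : Fin N → Fin 2) (s' : Fin N → S) :
    0 ≤ B.jointP s a s' := Finset.prod_nonneg fun _ _ => B.P_nonneg _ _ _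

lemma Bandit.sum_jointP (B : Bandit S) (s : Fin N → S) (a : Fin N → Fin 2) :
    ∑ s', B.jointP s a s' = 1 :=
  sum_prod_weights (w := fun n j => B.P (a n) (s n) j) fun n => B.P_sum _ _

lemma Bandit.kernel_mem_rowStochastic (B : Bandit S) (π : Policy S N) :
    B.kernel π ∈ rowStochastic ℝ (Fin N → S) := by
  rw [mem_rowStochastic_iff_sum]
  refine ⟨fun s s' => Finset.sum_nonneg fun a _ =>
    mul_nonneg (π.nonneg s a) (B.jointP_nonneg s a s'), fun s => ?_⟩
  simp only [kernel, of_apply]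
  rw [Finset.sum_comm]
  simp [← Finset.mul_sum, B.sum_jointP, π.sum_one]

lemma Bandit.kernel_mulVec (B : Bandit S) (π : Policy S N) (G : (Fin N → S) → ℝ) (s : Fin N → S) :
    (B.kernel π *ᵥ G) s = π.mean (fun s a => ∑ s', B.jointP s a s' * G s') s := by
  simp only [mulVec, dotProduct, kernel, of_apply, Policy.mean, Finset.sum_mul, Finset.mul_sum]
  rw [Finset.sum_comm]
  simp only [mul_assoc]

lemma Bandit.law_succ (B : Bandit S) (π : Policy S N) (s₀ : Fin N → S) (t : ℕ) :
    B.law π s₀ (t + 1) = B.law π s₀ t ᵥ* B.kernel π := by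
  funext s'
  simp only [law, vecMul, dotProduct, kernel, of_apply, Finset.mul_sum, mul_assoc]

lemma Bandit.law_nonneg (B : Bandit S) (π : Policy S N) (s₀ : Fin N → S) (t : ℕ) (s : Fin N → S) :
    0 ≤ B.law π s₀ t s := by
  induction t generalizing s with
  | zero => simp only [law]; split_ifs <;> norm_num
  | succ t ih =>
    rw [law_succ]
    exact Finset.sum_nonneg fun s _ => mul_nonneg (ih s)
      (nonneg_of_mem_rowStochastic (B.kernel_mem_rowStochastic π))

lemma Bandit.sum_law (B : Bandit S) (π : Policy S N) (s₀ : Fin N → S) (t : ℕ) :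
    ∑ s, B.law π s₀ t s = 1 := by
  induction t with
  | zero => simp [law]
  | succ t ih =>
    rw [law_succ, sum_vecMul_of_mem_rowStochastic (B.kernel_mem_rowStochastic π), ih]

lemma Bandit.expect_eq (B : Bandit S) (π : Policy S N) (s₀ : Fin N → S) (t : ℕ)
    (g : (Fin N → S) → (Fin N → Fin 2) → ℝ) :
    B.expect π s₀ t g = B.law π s₀ t ⬝ᵥ π.mean g := by
  simp only [expect, dotProduct, Policy.mean, Finset.mul_sum, mul_assoc]

lemma Bandit.law_dotProduct_mono (B : Bandit S) (π : Policy S N) (s₀ : Fin N → S) (t : ℕ)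
    {f g : (Fin N → S) → ℝ} (h : ∀ s, f s ≤ g s) :
    B.law π s₀ t ⬝ᵥ f ≤ B.law π s₀ t ⬝ᵥ g :=
  Finset.sum_le_sum fun s _ => mul_le_mul_of_nonneg_left (h s) (B.law_nonneg π s₀ t s)

lemma Bandit.law_dotProduct_const (B : Bandit S) (π : Policy S N) (s₀ : Fin N → S) (t : ℕ)
    (c : ℝ) : B.law π s₀ t ⬝ᵥ (fun _ => c) = c := by
  simp [dotProduct, ← Finset.sum_mul, B.sum_law]

lemma Bandit.abs_law_dotProduct_le (B : Bandit S) (π : Policy S N) (s₀ : Fin N → S)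
    (f : (Fin N → S) → ℝ) : ∃ c, ∀ t, |B.law π s₀ t ⬝ᵥ f| ≤ c := by
  refine ⟨‖f‖, fun t => ?_⟩
  have hf : ∀ s, |f s| ≤ ‖f‖ := fun s => by simpa using norm_le_pi_norm f s
  rw [abs_le]
  constructor
  · rw [← B.law_dotProduct_const π s₀ t (-‖f‖)]
    exact B.law_dotProduct_mono π s₀ t fun s => (abs_le.mp (hf s)).1
  · rw [← B.law_dotProduct_const π s₀ t ‖f‖]
    exact B.law_dotProduct_mono π s₀ t fun s => (abs_le.mp (hf s)).2

lemma Bandit.sum_law_dotProduct_coboundary (B : Bandit S) (π : Policy S N) (s₀ : Fin N → S)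
    (G : (Fin N → S) → ℝ) (T : ℕ) :
    ∑ t ∈ Finset.range T, B.law π s₀ t ⬝ᵥ (G - B.kernel π *ᵥ G) = G s₀ - B.law π s₀ T ⬝ᵥ G := by
  induction T with
  | zero => simp [law, dotProduct]
  | succ T ih =>
    rw [Finset.sum_range_succ, ih, law_succ, ← dotProduct_mulVec, dotProduct_sub]
    ring

lemma tendsto_one_div_mul_of_bounded {b : ℕ → ℝ} {c : ℝ} (hb : ∀ n, |b n| ≤ c) :
    Tendsto (fun T : ℕ => (1 / (T : ℝ)) * b T) atTop (𝓝 0) := by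
  refine squeeze_zero_norm (a := fun T : ℕ => (1 / (T : ℝ)) * c) (fun T => ?_) ?_
  · rw [norm_mul, Real.norm_eq_abs, Real.norm_eq_abs, abs_of_nonneg (by positivity)]
    exact mul_le_mul_of_nonneg_left (hb T) (by positivity)
  · simpa using tendsto_one_div_atTop_nhds_zero_nat.mul_const c

lemma Bandit.law_dotProduct_harmonic (B : Bandit S) (π : Policy S N) (s₀ : Fin N → S) (t : ℕ)
    {u : (Fin N → S) → ℝ} (hu : B.kernel π *ᵥ u = u) : B.law π s₀ t ⬝ᵥ u = u s₀ := by
  induction t with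
  | zero => simp [law, dotProduct]
  | succ t ih => rw [law_succ, ← dotProduct_mulVec, hu, ih]

lemma Bandit.tendsto_coboundary (B : Bandit S) (π : Policy S N) (s₀ : Fin N → S)
    (G : (Fin N → S) → ℝ) (c : ℝ) :
    Tendsto (fun T : ℕ => (1 / (T : ℝ)) *
      ∑ t ∈ Finset.range T, (c + B.law π s₀ t ⬝ᵥ (G - B.kernel π *ᵥ G))) atTop (𝓝 c) := by
  obtain ⟨C, hC⟩ := B.abs_law_dotProduct_le π s₀ G
  have h1 := tendsto_one_div_mul_of_bounded (b := fun T => G s₀ - B.law π s₀ T ⬝ᵥ G)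
    (c := |G s₀| + C) fun T => (abs_sub _ _).trans (by linarith [hC T])
  have h2 := h1.const_add c
  rw [add_zero] at h2
  refine h2.congr' ?_
  filter_upwards [eventually_gt_atTop 0] with T hT
  have hT' : (T : ℝ) ≠ 0 := by exact_mod_cast hT.ne'
  rw [Finset.sum_add_distrib, B.sum_law_dotProduct_coboundary]
  simp only [Finset.sum_const, Finset.card_range, nsmul_eq_mul]
  field_simp

/-- The expectation of the harmonic part does not depend on time, and the sum of the coboundary
telescopes to a bounded quantity. -/
theorem Bandit.hasAverage_of_coboundary (B : Bandit S) (π : Policy S N) (s₀ : Fin N → S)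
    {g : (Fin N → S) → (Fin N → Fin 2) → ℝ} {u G : (Fin N → S) → ℝ} (hu : B.kernel π *ᵥ u = u)
    (h : ∀ s, π.mean g s = u s + (G s - (B.kernel π *ᵥ G) s)) :
    B.HasAverage π s₀ g (u s₀) := by
  refine (B.tendsto_coboundary π s₀ G (u s₀)).congr fun T => ?_
  congr 1
  refine Finset.sum_congr rfl fun t _ => ?_
  rw [expect_eq, show π.mean g = u + (G - B.kernel π *ᵥ G) from funext h, dotProduct_add,
    B.law_dotProduct_harmonic π s₀ t hu]

theorem Bandit.hasAverage_of_const_add_coboundary (B : Bandit S) (π : Policy S N)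
    (s₀ : Fin N → S) {g : (Fin N → S) → (Fin N → Fin 2) → ℝ} {c : ℝ} {G : (Fin N → S) → ℝ}
    (h : ∀ s, π.mean g s = c + (G s - (B.kernel π *ᵥ G) s)) : B.HasAverage π s₀ g c := by
  refine B.hasAverage_of_coboundary π s₀ (u := fun _ => c) ?_ h
  funext s
  simp [mulVec, dotProduct, ← Finset.sum_mul,
    sum_row_of_mem_rowStochastic (B.kernel_mem_rowStochastic π)]

theorem Bandit.exists_hasAverage (B : Bandit S) (π : Policy S N) (s₀ : Fin N → S)
    (g : (Fin N → S) → (Fin N → Fin 2) → ℝ) : ∃ v, B.HasAverage π s₀ g v := by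
  obtain ⟨u, G, hu, h⟩ := exists_harmonic_add_coboundary (B.kernel_mem_rowStochastic π) (π.mean g)
  exact ⟨_, B.hasAverage_of_coboundary π s₀ hu fun s => congrFun h s⟩

/-- A one-sided Poisson inequality suffices for a lower bound. The Lyapunov argument for the
constructed policy uses it without any knowledge of the stationary law of the joint chain. -/
theorem Bandit.HasAverage.ge_of_drift {B : Bandit S} {π : Policy S N} {s₀ : Fin N → S}
    {g : (Fin N → S) → (Fin N → Fin 2) → ℝ} {v c : ℝ} (hv : B.HasAverage π s₀ g v)
    {G : (Fin N → S) → ℝ} (h : ∀ s, c + (G s - (B.kernel π *ᵥ G) s) ≤ π.mean g s) : c ≤ v := by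
  refine le_of_tendsto_of_tendsto' (B.tendsto_coboundary π s₀ G c) hv fun T => ?_
  refine mul_le_mul_of_nonneg_left (Finset.sum_le_sum fun t _ => ?_) (by positivity)
  rw [expect_eq]
  have := B.law_dotProduct_mono π s₀ t (f := (fun _ => c) + (G - B.kernel π *ᵥ G)) h
  rwa [dotProduct_add, B.law_dotProduct_const] at this

lemma Bandit.sum_jointP_mul_sum (B : Bandit S) (s : Fin N → S) (a : Fin N → Fin 2)
    (D : Finset (Fin N)) (f : Fin N → S → ℝ) :
    ∑ s', B.jointP s a s' * ∑ n ∈ D, f n (s' n) = ∑ n ∈ D, (B.P (a n) *ᵥ f n) (s n) :=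
  sum_prod_weights_mul_sum (w := fun n j => B.P (a n) (s n) j) (fun n => B.P_sum _ _) D f

end Policies

/-! ### Linearity, positivity and uniqueness of long-run averages. -/

section Averages

variable {S : Type*} [Fintype S] [DecidableEq S] {B : Bandit S} {N : ℕ} {π : Policy S N}
  {s₀ : Fin N → S}

lemma Bandit.HasAverage.unique {g : (Fin N → S) → (Fin N → Fin 2) → ℝ} {v w : ℝ}
    (hv : B.HasAverage π s₀ g v) (hw : B.HasAverage π s₀ g w) : v = w :=
  tendsto_nhds_unique hv hw

lemma Bandit.HasAverage.sum {κ : Type*} (F : Finset κ) (c : κ → ℝ)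
    {g : κ → (Fin N → S) → (Fin N → Fin 2) → ℝ} {v : κ → ℝ}
    (h : ∀ k ∈ F, B.HasAverage π s₀ (g k) (v k)) :
    B.HasAverage π s₀ (fun s a => ∑ k ∈ F, c k * g k s a) (∑ k ∈ F, c k * v k) := by
  refine (tendsto_finsetSum F fun k hk => (h k hk).const_mul (c k)).congr fun T => ?_
  have h1 : ∀ t, B.expect π s₀ t (fun s a => ∑ k ∈ F, c k * g k s a) =
      ∑ k ∈ F, c k * B.expect π s₀ t (g k) := by
    intro t
    simp only [Bandit.expect, Finset.mul_sum]
    rw [Finset.sum_comm (s := F)]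
    refine Finset.sum_congr rfl fun s _ => ?_
    rw [Finset.sum_comm (s := F)]
    exact Finset.sum_congr rfl fun a _ => Finset.sum_congr rfl fun k _ => by ring
  simp only [h1]
  rw [Finset.sum_comm (s := Finset.range T) (t := F), Finset.mul_sum]
  refine Finset.sum_congr rfl fun k _ => ?_
  rw [← Finset.mul_sum]; ring

lemma Bandit.HasAverage.nonneg {g : (Fin N → S) → (Fin N → Fin 2) → ℝ} {v : ℝ}
    (hv : B.HasAverage π s₀ g v) (hg : ∀ s a, 0 ≤ g s a) : 0 ≤ v := by
  refine ge_of_tendsto' hv fun T => mul_nonneg (by positivity) (Finset.sum_nonneg fun t _ => ?_)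
  exact Finset.sum_nonneg fun s _ => Finset.sum_nonneg fun a _ =>
    mul_nonneg (mul_nonneg (B.law_nonneg π s₀ t s) (π.nonneg s a)) (hg s a)

lemma Bandit.hasAverage_of_mean_eq {g : (Fin N → S) → (Fin N → Fin 2) → ℝ} {c : ℝ}
    (h : ∀ s, π.mean g s = c) : B.HasAverage π s₀ g c :=
  B.hasAverage_of_const_add_coboundary π s₀ (G := 0) fun s => by simp [h]

end Averages

/-! ### Occupation measures and the one-bandit linear program. -/

section Occupation

open Matrix

variable {S : Type*} [Fintype S] [DecidableEq S]

/-- `x` is the occupation measure of one stationary bandit. -/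
structure Bandit.IsOccupation (B : Bandit S) (x : S → Fin 2 → ℝ) : Prop where
  nonneg : ∀ i a, 0 ≤ x i a
  sum_one : ∑ i, ∑ a, x i a = 1
  balance : ∀ j, ∑ a, x j a = ∑ i, ∑ a, x i a * B.P a i j

/-- Every policy has a limiting occupation measure, averaged over the bandits. -/
theorem Bandit.exists_isOccupation (B : Bandit S) {N : ℕ} (hN : 1 ≤ N) (π : Policy S N)
    (s₀ : Fin N → S) : ∃ x, B.IsOccupation x ∧ ∀ f : S → Fin 2 → ℝ,
      B.HasAverage π s₀ (fun s a => ∑ n, f (s n) (a n)) (N * ∑ i, ∑ a, x i a * f i a) := by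
  have hN' : (N : ℝ) ≠ 0 := by positivity
  let c : S × Fin 2 → (Fin N → S) → (Fin N → Fin 2) → ℝ :=
    fun k s a => ∑ n, if (s n, a n) = k then 1 else 0
  choose y hy using fun k => B.exists_hasAverage π s₀ (c k)
  have havg : ∀ f : S → Fin 2 → ℝ,
      B.HasAverage π s₀ (fun s a => ∑ n, f (s n) (a n)) (∑ i, ∑ a, f i a * y (i, a)) := by
    intro f
    have h := Bandit.HasAverage.sum Finset.univ (fun k : S × Fin 2 => f k.1 k.2) fun k _ => hy k
    rw [Fintype.sum_prod_type] at h
    convert! h using 3 with s a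
    simp only [c, Finset.mul_sum]
    rw [Finset.sum_comm]
    simp
  refine ⟨fun i a => y (i, a) / N, ⟨fun i a => ?_, ?_, fun j => ?_⟩, fun f => ?_⟩
  · exact div_nonneg ((hy _).nonneg fun s a => Finset.sum_nonneg fun n _ => by
      split_ifs <;> norm_num) (Nat.cast_nonneg N)
  · have h1 := havg fun _ _ => 1
    have h2 : B.HasAverage π s₀ (fun s a => ∑ n : Fin N, (1 : ℝ)) N :=
      Bandit.hasAverage_of_mean_eq fun s => by
        simp [Policy.mean, ← Finset.sum_mul, π.sum_one]
    have h3 := h1.unique h2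
    simp only [one_mul] at h3
    simp only [← Finset.sum_div, h3]
    exact div_self hN'
  · have h1 := havg fun i a => (if i = j then 1 else 0) - B.P a i j
    -- The number of bandits in state `j` is a potential for this function: its expected one-step
    -- change averages to zero in the long run, which is the balance equation.
    have h2 : B.HasAverage π s₀
        (fun s a => ∑ n, ((if s n = j then (1 : ℝ) else 0) - B.P (a n) (s n) j)) 0 := by
      refine B.hasAverage_of_const_add_coboundary π s₀
        (G := fun s => ∑ n, if s n = j then (1 : ℝ) else 0) fun s => ?_
      have hP : ∀ (s : Fin N → S) a, ∑ s', B.jointP s a s' * ∑ n, (if s' n = j then (1 : ℝ) else 0) =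
          ∑ n, B.P (a n) (s n) j := fun s a => by
        have := B.sum_jointP_mul_sum s a Finset.univ fun _ i => if i = j then (1 : ℝ) else 0
        simpa [mulVec, dotProduct] using this
      rw [B.kernel_mulVec]
      simp only [hP]
      simp [Policy.mean, mul_sub, Finset.sum_sub_distrib, ← Finset.sum_mul, π.sum_one]
    have h3 := h1.unique h2
    simp only [sub_mul, Finset.sum_sub_distrib, ite_mul, one_mul, zero_mul] at h3
    rw [Finset.sum_comm] at h3
    simp only [Finset.sum_ite_eq', Finset.mem_univ, if_true, sub_eq_zero] at h3
    simp only [← Finset.sum_div, h3, div_mul_eq_mul_div, mul_comm]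
  · convert! havg f using 1
    simp only [Finset.mul_sum]
    refine Finset.sum_congr rfl fun i _ => Finset.sum_congr rfl fun a _ => ?_
    field_simp

/-- The deterministic policy that takes the action vector `a s` in the joint state `s`. -/
def detPolicy {S : Type*} {N : ℕ} (a : (Fin N → S) → Fin N → Fin 2) : Policy S N where
  prob s b := if b = a s then 1 else 0
  nonneg _ _ := by split_ifs <;> norm_num
  sum_one _ := by simp

lemma detPolicy_mean {N : ℕ} (a : (Fin N → S) → Fin N → Fin 2)
    (g : (Fin N → S) → (Fin N → Fin 2) → ℝ) (s : Fin N → S) :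
    (detPolicy a).mean g s = g s (a s) := by
  simp [Policy.mean, detPolicy]

/-- The policies "never activate" and "always activate" give activation rates `0` and `1`; convex
combinations then reach every `α` in between. -/
lemma Bandit.exists_isOccupation_const [Nonempty S] (B : Bandit S) (c : Fin 2) :
    ∃ x, B.IsOccupation x ∧ ∑ i, x i 1 = ((c : ℕ) : ℝ) := by
  obtain ⟨i₀⟩ := ‹Nonempty S›
  obtain ⟨x, hx, havg⟩ := B.exists_isOccupation le_rfl (detPolicy fun _ _ => c)
    fun _ => i₀
  refine ⟨x, hx, ?_⟩
  have h1 := havg fun _ a => ((a : ℕ) : ℝ)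
  have h2 : B.HasAverage (detPolicy fun _ _ => c) (fun _ => i₀) (fun (_ : Fin 1 → S) a => ∑ n, ((a n : ℕ) : ℝ))
      ((c : ℕ) : ℝ) := Bandit.hasAverage_of_mean_eq fun s => by simp [detPolicy_mean]
  simpa using h1.unique h2

/-- The occupation measures that activate the bandit in a proportion `α` of the time. -/
def Bandit.feasible (B : Bandit S) (α : ℝ) : Set (S → Fin 2 → ℝ) :=
  {x | B.IsOccupation x ∧ ∑ i, x i 1 = α}

lemma Bandit.feasible_nonempty [Nonempty S] (B : Bandit S) {α : ℝ} (h0 : 0 ≤ α) (h1 : α ≤ 1) :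
    (B.feasible α).Nonempty := by
  obtain ⟨x, hx, hx1⟩ := B.exists_isOccupation_const 0
  obtain ⟨y, hy, hy1⟩ := B.exists_isOccupation_const 1
  refine ⟨fun i a => (1 - α) * x i a + α * y i a, ⟨fun i a => ?_, ?_, fun j => ?_⟩, ?_⟩
  · exact add_nonneg (mul_nonneg (by linarith) (hx.nonneg i a)) (mul_nonneg h0 (hy.nonneg i a))
  · simp only [Finset.sum_add_distrib, ← Finset.mul_sum, hx.sum_one, hy.sum_one]; ring
  · simp only [add_mul, mul_assoc, Finset.sum_add_distrib, ← Finset.mul_sum, hx.balance j,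
      hy.balance j]
  · simp only [Finset.sum_add_distrib, ← Finset.mul_sum, hx1, hy1]; simp

lemma Bandit.isCompact_feasible (B : Bandit S) (α : ℝ) : IsCompact (B.feasible α) := by
  have hsub : B.feasible α ⊆ Set.Icc 0 1 := by
    rintro x ⟨hx, -⟩
    refine ⟨fun i a => hx.nonneg i a, fun i a => ?_⟩
    calc x i a ≤ ∑ a, x i a :=
          Finset.single_le_sum (fun a _ => hx.nonneg i a) (Finset.mem_univ a)
      _ ≤ ∑ i, ∑ a, x i a := Finset.single_le_sum (f := fun i => ∑ a, x i a)
          (fun i _ => Finset.sum_nonneg fun a _ => hx.nonneg i a) (Finset.mem_univ i)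
      _ = 1 := hx.sum_one
  refine isCompact_Icc.of_isClosed_subset ?_ hsub
  have : B.feasible α = (⋂ i, ⋂ a, {x | 0 ≤ x i a}) ∩ {x | ∑ i, ∑ a, x i a = 1} ∩
      (⋂ j, {x | ∑ a, x j a = ∑ i, ∑ a, x i a * B.P a i j}) ∩ {x | ∑ i, x i 1 = α} := by
    ext x
    simp only [feasible, Set.mem_ofPred_eq, Set.mem_inter_iff, Set.mem_iInter]
    exact ⟨fun ⟨h, h'⟩ => ⟨⟨⟨h.nonneg, h.sum_one⟩, h.balance⟩, h'⟩,
      fun ⟨⟨⟨h1, h2⟩, h3⟩, h4⟩ => ⟨⟨h1, h2, h3⟩, h4⟩⟩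
  rw [this]
  refine ((IsClosed.inter ?_ ?_).inter ?_).inter ?_
  · exact isClosed_iInter fun i => isClosed_iInter fun a =>
      isClosed_le continuous_const (by fun_prop)
  · exact isClosed_eq (by fun_prop) continuous_const
  · exact isClosed_iInter fun j => isClosed_eq (by fun_prop) (by fun_prop)
  · exact isClosed_eq (by fun_prop) continuous_const

end Occupation

/-! ### The optimal randomized policy of one bandit and the relaxed value. -/

section Mixture

open Matrix

variable {S : Type*} [Fintype S] [DecidableEq S]

/-- Transition matrix of one bandit that is activated with probability `p i` in the state `i`. -/
def Bandit.mixP (B : Bandit S) (p : S → ℝ) : Matrix S S ℝ :=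
  Matrix.of fun i j => (1 - p i) * B.P 0 i j + p i * B.P 1 i j

/-- Mean of `f i a` when the action is `1` with probability `p i`. -/
def mix (p : S → ℝ) (f : S → Fin 2 → ℝ) (i : S) : ℝ := (1 - p i) * f i 0 + p i * f i 1

lemma Bandit.mixP_mulVec (B : Bandit S) (p g : S → ℝ) :
    B.mixP p *ᵥ g = mix p fun i a => (B.P a *ᵥ g) i := by
  funext i
  simp only [mulVec, dotProduct, mixP, of_apply, mix, add_mul, Finset.sum_add_distrib,
    Finset.mul_sum, mul_assoc]

lemma Bandit.mixP_mem_rowStochastic (B : Bandit S) {p : S → ℝ} (hp : ∀ i, 0 ≤ p i ∧ p i ≤ 1) :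
    B.mixP p ∈ rowStochastic ℝ S := by
  rw [mem_rowStochastic_iff_sum]
  refine ⟨fun i j => add_nonneg (mul_nonneg (by linarith [(hp i).2]) (B.P_nonneg _ _ _))
    (mul_nonneg (hp i).1 (B.P_nonneg _ _ _)), fun i => ?_⟩
  simp [mixP, Finset.sum_add_distrib, ← Finset.mul_sum, B.P_sum]

/-- The deterministic policy that is active exactly where `p > 0` uses only transitions that the
mixture also allows, so its Doeblin condition is inherited. -/
theorem Bandit.IsAperiodicUnichain.exists_mixP_pow_pos {B : Bandit S} (hB : B.IsAperiodicUnichain)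
    {p : S → ℝ} (hp : ∀ i, 0 ≤ p i ∧ p i ≤ 1) : ∃ (K : ℕ) (j : S), ∀ i, 0 < (B.mixP p ^ K) i j := by
  let f : S → Fin 2 := fun i => if 0 < p i then 1 else 0
  have hf0 : ∀ i j, 0 ≤ B.policyMatrix f i j := fun i j => B.P_nonneg _ _ _
  obtain ⟨K, j, h⟩ := (hB f).exists_pow_pos hf0
  refine ⟨K, j, fun i => pow_pos_of_support_le hf0 (fun i j => nonneg_of_mem_rowStochastic
    (B.mixP_mem_rowStochastic hp)) (fun i j hij => ?_) K i j (h i)⟩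
  simp only [policyMatrix, f, of_apply] at hij
  simp only [mixP, of_apply]
  split_ifs at hij with hi
  · exact add_pos_of_nonneg_of_pos (mul_nonneg (by linarith [(hp i).2]) (B.P_nonneg _ _ _))
      (mul_pos hi hij)
  · have : p i = 0 := le_antisymm (not_lt.mp hi) (hp i).1
    simpa [this] using hij

/-- The policy that activates each bandit independently, with probability `p i` in state `i`. -/
def indepPolicy (p : S → ℝ) (hp : ∀ i, 0 ≤ p i ∧ p i ≤ 1) (N : ℕ) : Policy S N where
  prob s a := ∏ n, ![1 - p (s n), p (s n)] (a n)
  nonneg s a := Finset.prod_nonneg fun n _ => by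
    generalize a n = b
    fin_cases b
    · simpa using (hp (s n)).2
    · simpa using (hp (s n)).1
  sum_one s := sum_prod_weights (w := fun n a => ![1 - p (s n), p (s n)] a) fun n => by simp

lemma indepPolicy_mean {p : S → ℝ} (hp : ∀ i, 0 ≤ p i ∧ p i ≤ 1) {N : ℕ} (f : S → Fin 2 → ℝ)
    (s : Fin N → S) : (indepPolicy p hp N).mean (fun s a => ∑ n, f (s n) (a n)) s =
      ∑ n, mix p f (s n) := by
  have := sum_prod_weights_mul_sum (w := fun n a => ![1 - p (s n), p (s n)] a)
    (fun n => by simp) Finset.univ fun n => f (s n)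
  simpa [Policy.mean, indepPolicy, mix] using this

/-- Summing the one-bandit Poisson solution over the bandits solves the Poisson equation of the
joint chain, so the average does not depend on the initial state. -/
theorem Bandit.hasAverage_indepPolicy {B : Bandit S} (hB : B.IsAperiodicUnichain) {p μ : S → ℝ}
    (hp : ∀ i, 0 ≤ p i ∧ p i ≤ 1) (hμ : μ ᵥ* B.mixP p = μ) (hμ1 : ∑ i, μ i = 1) {N : ℕ}
    (s₀ : Fin N → S) (f : S → Fin 2 → ℝ) :
    B.HasAverage (indepPolicy p hp N) s₀ (fun s a => ∑ n, f (s n) (a n))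
      (N * ∑ i, μ i * mix p f i) := by
  obtain ⟨K, j, hK⟩ := hB.exists_mixP_pow_pos hp
  obtain ⟨g, hg⟩ := exists_poisson (B.mixP_mem_rowStochastic hp) hK hμ hμ1 (mix p f)
  refine B.hasAverage_of_const_add_coboundary _ s₀ (G := fun s => ∑ n, g (s n)) fun s => ?_
  have hP : ∀ (s : Fin N → S) a, ∑ s', B.jointP s a s' * ∑ n, g (s' n) = ∑ n, (B.P (a n) *ᵥ g) (s n) :=
    fun s a => B.sum_jointP_mul_sum s a Finset.univ fun _ => g
  rw [B.kernel_mulVec]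
  simp only [hP]
  have h := indepPolicy_mean hp (fun i a => (B.P a *ᵥ g) i) s
  rw [← B.mixP_mulVec] at h
  rw [h, indepPolicy_mean hp f s, Finset.sum_congr rfl fun n _ => hg (s n)]
  simp [Finset.sum_add_distrib, Finset.sum_sub_distrib]

/-- A stationary randomized policy of one bandit that is optimal for the relaxed problem. -/
structure Bandit.OptimalMixture (B : Bandit S) (α : ℝ) where
  p : S → ℝ
  μ : S → ℝ
  p_mem : ∀ i, 0 ≤ p i ∧ p i ≤ 1
  p_eq : α = 0 ∨ α = 1 → ∀ i, p i = α
  μ_nonneg : ∀ i, 0 ≤ μ i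
  μ_sum : ∑ i, μ i = 1
  stationary : μ ᵥ* B.mixP p = μ
  active : ∑ i, μ i * p i = α
  optimal : ∀ x ∈ B.feasible α,
    ∑ i, ∑ a, x i a * B.R a i ≤ ∑ i, μ i * mix p (fun i a => B.R a i) i

theorem Bandit.nonempty_optimalMixture [Nonempty S] (B : Bandit S) {α : ℝ} (h0 : 0 ≤ α)
    (h1 : α ≤ 1) : Nonempty (B.OptimalMixture α) := by
  obtain ⟨x, ⟨hx, hxα⟩, hmax⟩ := (B.isCompact_feasible α).exists_isMaxOn
    (B.feasible_nonempty h0 h1) (f := fun x => ∑ i, ∑ a, x i a * B.R a i)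
    (by fun_prop)
  let μ : S → ℝ := fun i => x i 0 + x i 1
  -- In states of mass zero `p` is free. The value `α` makes `p` constant when `α` is `0` or `1`, so
  -- that the independent policy then meets the hard constraint.
  let p : S → ℝ := fun i => if μ i = 0 then α else x i 1 / μ i
  have hμ0 : ∀ i, 0 ≤ μ i := fun i => add_nonneg (hx.nonneg i 0) (hx.nonneg i 1)
  have hx1 : ∀ i, μ i * p i = x i 1 := by
    intro i
    simp only [p]
    split_ifs with h
    · have : x i 1 = 0 := le_antisymm (by linarith [hx.nonneg i 0, show x i 0 + x i 1 = 0 from h])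
        (hx.nonneg i 1)
      rw [h, this, zero_mul]
    · field_simp
  have hx0 : ∀ i, μ i * (1 - p i) = x i 0 := fun i => by
    rw [mul_sub, hx1]; simp [μ]
  have hmix : ∀ f : S → Fin 2 → ℝ, ∑ i, μ i * mix p f i = ∑ i, ∑ a, x i a * f i a := by
    intro f
    refine Finset.sum_congr rfl fun i _ => ?_
    rw [mix, mul_add, ← mul_assoc, ← mul_assoc, hx0, hx1, Fin.sum_univ_two]
  refine ⟨⟨p, μ, fun i => ?_, fun hα i => ?_, hμ0, ?_, ?_, by simp only [hx1, hxα], fun y hy => ?_⟩⟩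
  · simp only [p]
    split_ifs with h
    · exact ⟨h0, h1⟩
    · have hpos : 0 < μ i := lt_of_le_of_ne (hμ0 i) (Ne.symm h)
      refine ⟨div_nonneg (hx.nonneg i 1) (hμ0 i), ?_⟩
      rw [div_le_one hpos]
      simp only [μ]
      linarith [hx.nonneg i 0]
  · simp only [p]
    split_ifs with h
    · rfl
    · rcases hα with rfl | rfl
      · have : x i 1 = 0 := (Finset.sum_eq_zero_iff_of_nonneg fun i _ => hx.nonneg i 1).mp hxα i
          (Finset.mem_univ i)
        rw [this, zero_div]
      · have hs := hx.sum_one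
        simp only [Fin.sum_univ_two, Finset.sum_add_distrib, hxα] at hs
        have : x i 0 = 0 := (Finset.sum_eq_zero_iff_of_nonneg fun i _ => hx.nonneg i 0).mp
          (by linarith) i (Finset.mem_univ i)
        rw [div_eq_one_iff_eq h]
        simp [μ, this]
  · simpa [μ, Fin.sum_univ_two] using hx.sum_one
  · funext j
    have := hmix fun i a => B.P a i j
    rw [← hx.balance j, Fin.sum_univ_two] at this
    exact this
  · rw [hmix]
    exact hmax hy

/-- The optimal reward rate of one bandit in the relaxed problem. -/
def Bandit.OptimalMixture.value {B : Bandit S} {α : ℝ} (m : B.OptimalMixture α) : ℝ :=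
  ∑ i, m.μ i * mix m.p (fun i a => B.R a i) i

variable {B : Bandit S} {α : ℝ}

theorem Bandit.OptimalMixture.le_value (m : B.OptimalMixture α) {N : ℕ} (hN : 1 ≤ N)
    {π : Policy S N} {s₀ : Fin N → S} {v : ℝ}
    (hact : B.HasAverage π s₀ (fun _ a => numActive a) (α * N))
    (hv : B.HasAverage π s₀ B.reward v) : v ≤ N * m.value := by
  obtain ⟨x, hx, havg⟩ := B.exists_isOccupation hN π s₀
  have hN' : (N : ℝ) ≠ 0 := by positivity
  have h1 : N * ∑ i, ∑ a, x i a * ((a : ℕ) : ℝ) = α * N :=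
    (havg fun _ a => ((a : ℕ) : ℝ)).unique hact
  have h2 : N * ∑ i, ∑ a, x i a * B.R a i = v := (havg fun i a => B.R a i).unique hv
  rw [← h2]
  refine mul_le_mul_of_nonneg_left (m.optimal x ⟨hx, ?_⟩) (Nat.cast_nonneg N)
  simp only [Fin.sum_univ_two] at h1
  simp only [Fin.val_zero, Nat.cast_zero, mul_zero, Fin.val_one, Nat.cast_one, mul_one,
    zero_add] at h1
  exact mul_left_cancel₀ hN' (by linarith)

theorem Bandit.OptimalMixture.hasAverage_reward (hB : B.IsAperiodicUnichain)
    (m : B.OptimalMixture α) {N : ℕ} (s₀ : Fin N → S) :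
    B.HasAverage (indepPolicy m.p m.p_mem N) s₀ B.reward (N * m.value) :=
  B.hasAverage_indepPolicy hB m.p_mem m.stationary m.μ_sum s₀ fun i a => B.R a i

theorem Bandit.OptimalMixture.relValue_eq (hB : B.IsAperiodicUnichain) (m : B.OptimalMixture α)
    {N : ℕ} (hN : 1 ≤ N) (s₀ : Fin N → S) : B.relValue α N s₀ = N * m.value := by
  refine IsGreatest.csSup_eq ⟨⟨indepPolicy m.p m.p_mem N, ?_, m.hasAverage_reward hB s₀⟩, ?_⟩
  · have := B.hasAverage_indepPolicy hB m.p_mem m.stationary m.μ_sum s₀ fun i a => ((a : ℕ) : ℝ)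
    simp only [mix, Fin.val_zero, Nat.cast_zero, mul_zero, Fin.val_one, Nat.cast_one, mul_one,
      zero_add, m.active] at this
    rwa [mul_comm] at this
  · rintro v ⟨π, hact, hv⟩
    exact m.le_value hN hact hv

lemma hasAverage_numActive {N : ℕ} {π : Policy S N} (s₀ : Fin N → S)
    (hπ : ∀ s a, 0 < π.prob s a → numActive a = α * N) :
    B.HasAverage π s₀ (fun _ a => numActive a) (α * N) := by
  refine Bandit.hasAverage_of_mean_eq fun s => ?_
  have : ∀ a, π.prob s a * numActive a = π.prob s a * (α * N) := fun a => by
    rcases (π.nonneg s a).lt_or_eq with h | h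
    · rw [hπ s a h]
    · rw [← h, zero_mul, zero_mul]
  simp only [Policy.mean, this, ← Finset.sum_mul, π.sum_one, one_mul]

/-- A hard-feasible policy whose reward rate is at least `v` bounds the optimal value below, and the
relaxed value bounds it above. -/
theorem Bandit.OptimalMixture.abs_optValue_sub_le (m : B.OptimalMixture α) {N : ℕ} (hN : 1 ≤ N)
    {π : Policy S N} {s₀ : Fin N → S} (hπ : ∀ s a, 0 < π.prob s a → numActive a = α * N) {v c : ℝ}
    (hv : B.HasAverage π s₀ B.reward v) (hc : N * m.value - c ≤ v) :
    |B.optValue α N s₀ - N * m.value| ≤ c := by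
  have hub : ∀ w ∈ {v : ℝ | ∃ π : Policy S N,
      (∀ s a, 0 < π.prob s a → numActive a = α * N) ∧ B.HasAverage π s₀ B.reward v},
      w ≤ N * m.value := by
    rintro w ⟨π', hπ', hw⟩
    exact m.le_value hN (hasAverage_numActive s₀ hπ') hw
  have h1 : v ≤ B.optValue α N s₀ := le_csSup ⟨_, hub⟩ ⟨π, hπ, hv⟩
  have h2 : B.optValue α N s₀ ≤ N * m.value := csSup_le ⟨v, π, hπ, hv⟩ hub
  rw [abs_le]
  constructor <;> linarith

end Mixture

/-! ### Rounding proportions to subsets, and deviation from `μ`. -/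

section Rounding

variable {ι S : Type*} [DecidableEq ι] [Fintype S] [DecidableEq S]

/-- The number of bandits of `D` in the state `i`. -/
def count (s : ι → S) (D : Finset ι) (i : S) : ℕ := (D.filter (s · = i)).card

lemma sum_apply_eq_sum_count (s : ι → S) (D : Finset ι) (f : S → ℝ) :
    ∑ k ∈ D, f (s k) = ∑ i, count s D i * f i := by
  rw [← Finset.sum_fiberwise D s]
  refine Finset.sum_congr rfl fun i _ => ?_
  rw [Finset.sum_congr rfl fun k hk => by rw [(Finset.mem_filter.mp hk).2]]
  simp [count]

lemma card_eq_sum_count (s : ι → S) (D : Finset ι) : (D.card : ℝ) = ∑ i, (count s D i : ℝ) := by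
  have := sum_apply_eq_sum_count s D fun _ => 1
  simpa using this

lemma exists_subset_count_eq (s : ι → S) (D : Finset ι) {c : S → ℕ} (hc : ∀ i, c i ≤ count s D i) :
    ∃ T ⊆ D, ∀ i, count s T i = c i := by
  choose t ht htc using fun i => Finset.exists_subset_card_eq (hc i)
  have hmem : ∀ i k, k ∈ t i → k ∈ D ∧ s k = i := fun i k hk => Finset.mem_filter.mp (ht i hk)
  refine ⟨Finset.univ.biUnion t, fun k hk => ?_, fun i => ?_⟩
  · obtain ⟨i, -, hi⟩ := Finset.mem_biUnion.mp hk
    exact (hmem i k hi).1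
  · rw [← htc i, count]
    congr 1
    ext k
    simp only [Finset.mem_filter, Finset.mem_biUnion, Finset.mem_univ, true_and]
    constructor
    · rintro ⟨⟨j, hj⟩, rfl⟩
      rwa [(hmem j k hj).2]
    · intro hk
      exact ⟨⟨i, hk⟩, (hmem i k hk).2⟩

/-- A subset that takes a prescribed proportion of the bandits in each state, up to rounding. -/
theorem exists_rounding (s : ι → S) (D : Finset ι) {p : S → ℝ} (hp : ∀ i, 0 ≤ p i ∧ p i ≤ 1) :
    ∃ T ⊆ D, (T.card : ℝ) ≤ ∑ k ∈ D, p (s k) ∧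
      ∀ f : S → ℝ, |∑ k ∈ T, f (s k) - ∑ k ∈ D, p (s k) * f (s k)| ≤ ∑ i, |f i| := by
  have h0 : ∀ i, 0 ≤ p i * count s D i := fun i => mul_nonneg (hp i).1 (Nat.cast_nonneg _)
  -- Rounding down in each state separately costs at most one bandit per state, whence the error `∑
  -- i, |f i|`, independent of `N`.
  obtain ⟨T, hT, hc⟩ := exists_subset_count_eq s D (c := fun i => ⌊p i * count s D i⌋₊) fun i => by
    have : (⌊p i * count s D i⌋₊ : ℝ) ≤ count s D i :=
      (Nat.floor_le (h0 i)).trans (mul_le_of_le_one_left (Nat.cast_nonneg _) (hp i).2)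
    exact_mod_cast this
  have hle : ∀ i, (count s T i : ℝ) ≤ p i * count s D i := fun i => by
    rw [hc]; exact Nat.floor_le (h0 i)
  have hge : ∀ i, p i * count s D i ≤ count s T i + 1 := fun i => by
    rw [hc]; exact (Nat.lt_floor_add_one _).le
  refine ⟨T, hT, ?_, fun f => ?_⟩
  · rw [card_eq_sum_count s T, sum_apply_eq_sum_count s D p]
    exact Finset.sum_le_sum fun i _ => by linarith [hle i]
  · rw [sum_apply_eq_sum_count s T f, sum_apply_eq_sum_count s D fun i => p i * f i,
      ← Finset.sum_sub_distrib]
    refine (Finset.abs_sum_le_sum_abs _ _).trans (Finset.sum_le_sum fun i _ => ?_)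
    rw [show (count s T i : ℝ) * f i - count s D i * (p i * f i) =
      (count s T i - p i * count s D i) * f i by ring, abs_mul]
    refine mul_le_of_le_one_left (abs_nonneg _) ?_
    rw [abs_le]
    constructor <;> linarith [hle i, hge i]

/-- The deviation of the states of the bandits in `D` from the distribution `μ`. -/
def imbalance (μ : S → ℝ) (s : ι → S) (D : Finset ι) : S → ℝ :=
  fun j => ∑ k ∈ D, ((if s k = j then 1 else 0) - μ j)

lemma imbalance_eq (μ : S → ℝ) (s : ι → S) (D : Finset ι) (j : S) :
    imbalance μ s D j = count s D j - D.card * μ j := by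
  simp [imbalance, count, Finset.sum_sub_distrib]

lemma sum_imbalance_mul (μ : S → ℝ) (s : ι → S) (D : Finset ι) (f : S → ℝ) :
    ∑ j, imbalance μ s D j * f j = ∑ k ∈ D, f (s k) - D.card * ∑ j, μ j * f j := by
  simp only [imbalance_eq, sub_mul, Finset.sum_sub_distrib, sum_apply_eq_sum_count s D f,
    Finset.mul_sum, mul_assoc]

lemma sum_imbalance {μ : S → ℝ} (hμ : ∑ j, μ j = 1) (s : ι → S) (D : Finset ι) :
    ∑ j, imbalance μ s D j = 0 := by
  have := sum_imbalance_mul μ s D fun _ => 1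
  simpa [hμ] using this

lemma sum_abs_imbalance_le {μ : S → ℝ} (hμ0 : ∀ j, 0 ≤ μ j) (hμ : ∑ j, μ j = 1) (s : ι → S)
    (D : Finset ι) : ∑ j, |imbalance μ s D j| ≤ 2 * D.card := by
  calc ∑ j, |imbalance μ s D j| ≤ ∑ j, ((count s D j : ℝ) + D.card * μ j) := by
        refine Finset.sum_le_sum fun j _ => ?_
        rw [imbalance_eq]
        refine (abs_sub _ _).trans ?_
        rw [abs_of_nonneg (Nat.cast_nonneg _),
          abs_of_nonneg (mul_nonneg (Nat.cast_nonneg _) (hμ0 j))]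
    _ = 2 * D.card := by
        rw [Finset.sum_add_distrib, ← Finset.mul_sum, hμ, ← card_eq_sum_count]; ring

lemma imbalance_union (μ : S → ℝ) (s : ι → S) {D E : Finset ι} (h : Disjoint D E) :
    imbalance μ s (D ∪ E) = imbalance μ s D + imbalance μ s E := by
  funext j
  simp [imbalance, Finset.sum_union h]

end Rounding

/-! ### Largest admissible sets and how they grow or shrink. -/

section Controlled

open Matrix

variable {S : Type*} [Fintype S] [DecidableEq S] {M : Matrix S S ℝ} (Φ : ContractedNorm M)
  (μ : S → ℝ) (θ : ℝ) {N : ℕ}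

lemma ContractedNorm.nonneg (y : S → ℝ) : 0 ≤ Φ.toFun y :=
  (Finset.sum_nonneg fun _ _ => abs_nonneg _).trans (Φ.sum_abs_le y)

/-- The bandits of `D` are so well balanced that the other bandits can compensate for the
deviation of their activation budget. -/
def Admissible (s : Fin N → S) (D : Finset (Fin N)) : Prop :=
  D = ∅ ∨ Φ.toFun (imbalance μ s D) + Fintype.card S ≤ θ * (N - D.card)

lemma exists_largest_admissible (s : Fin N → S) : ∃ D, Admissible Φ μ θ s D ∧
    ∀ D', Admissible Φ μ θ s D' → D'.card ≤ D.card := by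
  classical
  obtain ⟨D, hD, hmax⟩ := Finset.exists_max_image
    (Finset.univ.filter fun D : Finset (Fin N) => Admissible Φ μ θ s D) Finset.card
    ⟨∅, Finset.mem_filter.mpr ⟨Finset.mem_univ _, Or.inl rfl⟩⟩
  exact ⟨D, (Finset.mem_filter.mp hD).2, fun D' hD' =>
    hmax D' (Finset.mem_filter.mpr ⟨Finset.mem_univ _, hD'⟩)⟩

/-- A largest admissible set. -/
noncomputable def controlled (s : Fin N → S) : Finset (Fin N) :=
  (exists_largest_admissible Φ μ θ s).choose

/-- The number of bandits outside the largest admissible set. -/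
noncomputable def uncontrolled (s : Fin N → S) : ℝ := N - (controlled Φ μ θ s).card

lemma admissible_controlled (s : Fin N → S) : Admissible Φ μ θ s (controlled Φ μ θ s) :=
  (exists_largest_admissible Φ μ θ s).choose_spec.1

lemma uncontrolled_le {s : Fin N → S} {D : Finset (Fin N)} (hD : Admissible Φ μ θ s D) :
    uncontrolled Φ μ θ s ≤ N - D.card := by
  have : (D.card : ℝ) ≤ (controlled Φ μ θ s).card :=
    Nat.cast_le.mpr ((exists_largest_admissible Φ μ θ s).choose_spec.2 D hD)
  rw [uncontrolled]; linarith

lemma uncontrolled_nonneg (s : Fin N → S) : 0 ≤ uncontrolled Φ μ θ s := by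
  have : ((controlled Φ μ θ s).card : ℝ) ≤ N := by
    exact_mod_cast (Finset.card_le_univ _).trans_eq (Fintype.card_fin N)
  rw [uncontrolled]; linarith

variable {θ μ}

/-- The empty set is admissible by decree, but its deviation vanishes, so the bound holds for it
too. -/
lemma norm_imbalance_controlled_le (hθ : 0 ≤ θ) (s : Fin N → S) :
    Φ.toFun (imbalance μ s (controlled Φ μ θ s)) ≤ θ * uncontrolled Φ μ θ s := by
  rcases admissible_controlled Φ μ θ s with h | h
  · have h0 : imbalance μ s (controlled Φ μ θ s) = (0 : ℝ) • 0 := by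
      rw [h]; funext j; simp [imbalance]
    rw [h0, Φ.smul, abs_zero, zero_mul]
    exact mul_nonneg hθ (uncontrolled_nonneg Φ μ θ s)
  · rw [uncontrolled]
    linarith [(Nat.cast_nonneg (Fintype.card S) : (0 : ℝ) ≤ Fintype.card S)]

/-- If the deviation leaves room, the set can be enlarged. -/
lemma uncontrolled_le_of_small (hμ0 : ∀ j, 0 ≤ μ j) (hμ : ∑ j, μ j = 1) (hθ : 0 < θ)
    (s : Fin N → S) (D : Finset (Fin N))
    (h : Φ.toFun (imbalance μ s D) + Fintype.card S ≤ θ * (N - D.card)) :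
    uncontrolled Φ μ θ s ≤ (Φ.toFun (imbalance μ s D) + 2 * Φ.C * (N - D.card) + Fintype.card S) /
      (2 * Φ.C + θ) + 1 := by
  set A := Φ.toFun (imbalance μ s D)
  set d : ℝ := (Fintype.card S : ℝ)
  have hd : 0 ≤ d := Nat.cast_nonneg _
  have hA : 0 ≤ A := Φ.nonneg _
  have hC := Φ.C_pos
  have hpos : 0 < 2 * Φ.C + θ := by linarith
  have hDN : D.card ≤ N := (Finset.card_le_univ _).trans_eq (Fintype.card_fin N)
  have hDN' : (D.card : ℝ) ≤ N := by exact_mod_cast hDN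
  -- Each added bandit costs at most `2 * Φ.C` of norm. With `n` bandits left outside, admissibility
  -- follows from `A + 2 C (N - |D| - n) + d ≤ θ n`, that is, from `q ≤ n`.
  set q := (A + 2 * Φ.C * (N - D.card) + d) / (2 * Φ.C + θ)
  have hq0 : 0 ≤ q := div_nonneg (by nlinarith) hpos.le
  have hqle : q ≤ ((N - D.card : ℕ) : ℝ) := by
    rw [Nat.cast_sub hDN, div_le_iff₀ hpos]; linarith
  have hu : ⌈q⌉₊ ≤ N - D.card := Nat.ceil_le.mpr hqle
  obtain ⟨D', hDD', -, hD'⟩ := Finset.exists_subsuperset_card_eq (Finset.subset_univ D)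
    (n := N - ⌈q⌉₊) (by omega) (by rw [Finset.card_univ, Fintype.card_fin]; omega)
  have hcard : (D'.card : ℝ) = N - ⌈q⌉₊ := by rw [hD', Nat.cast_sub (by omega)]
  have hsd : ((D' \ D).card : ℝ) = N - ⌈q⌉₊ - D.card := by
    rw [Finset.card_sdiff_of_subset hDD', Nat.cast_sub (Finset.card_le_card hDD'), hcard]
  have hΦ : Φ.toFun (imbalance μ s D') ≤ A + Φ.C * (2 * (N - ⌈q⌉₊ - D.card)) := by
    rw [← Finset.union_sdiff_of_subset hDD', imbalance_union μ s Finset.disjoint_sdiff, ← hsd]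
    refine (Φ.add_le _ _).trans (add_le_add le_rfl ((Φ.le_sum_abs _).trans ?_))
    exact mul_le_mul_of_nonneg_left (sum_abs_imbalance_le hμ0 hμ s _) hC.le
  have hqceil : q ≤ ⌈q⌉₊ := Nat.le_ceil q
  have hadm : Admissible Φ μ θ s D' := by
    right
    rw [hcard]
    have h1 : A + 2 * Φ.C * (N - D.card) + d ≤ ⌈q⌉₊ * (2 * Φ.C + θ) := by
      rw [← div_le_iff₀ hpos]; exact hqceil
    linarith
  have := uncontrolled_le Φ μ θ hadm
  rw [hcard] at this
  linarith [Nat.ceil_lt_add_one hq0]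

/-- If the deviation is too large, the set can be thinned out without changing its composition. -/
lemma uncontrolled_le_of_large (hμ0 : ∀ j, 0 ≤ μ j) (hμ : ∑ j, μ j = 1) (hθ : 0 < θ)
    (s : Fin N → S) (D : Finset (Fin N))
    (h : θ * (N - D.card) ≤ Φ.toFun (imbalance μ s D) + Fintype.card S) :
    uncontrolled Φ μ θ s ≤ (Φ.toFun (imbalance μ s D) + 2 * Fintype.card S * Φ.C +
      Fintype.card S) / θ + Fintype.card S := by
  set A := Φ.toFun (imbalance μ s D) with hAdef
  set d : ℝ := (Fintype.card S : ℝ) with hddef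
  have hd : 0 ≤ d := Nat.cast_nonneg _
  have hA : 0 ≤ A := Φ.nonneg _
  have hC := Φ.C_pos
  -- Once `b` bandits are outside, the set may have norm up to `A + 2 d C`; `m` is how many must be
  -- removed for this.
  set b := (A + 2 * d * Φ.C + d) / θ with hb
  have hbθ : θ * b = A + 2 * d * Φ.C + d := by rw [hb]; field_simp
  set m := b - (N - D.card) with hm
  have hm0 : 0 ≤ m := by
    have : 0 ≤ θ * m := by
      rw [hm, mul_sub, hbθ]
      nlinarith [mul_nonneg hd hC.le]
    exact nonneg_of_mul_nonneg_right this hθ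
  by_cases hmD : (D.card : ℝ) ≤ m
  -- Here all of `D` would have to go, and the empty set is always admissible.
  · have := uncontrolled_le Φ μ θ (s := s) (D := ∅) (Or.inl rfl)
    simp only [Finset.card_empty, Nat.cast_zero] at this
    linarith
  push Not at hmD
  have hDpos : (0 : ℝ) < D.card := by linarith
  -- Keeping the proportion `l` of each state scales the deviation by `l ≤ 1`, up to a rounding
  -- error of `ℓ¹` norm at most `2 d`.
  set l := 1 - m / D.card with hl
  have hlD : l * D.card = D.card - m := by rw [hl]; field_simp
  have hl01 : 0 ≤ l ∧ l ≤ 1 := by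
    have : m / D.card ≤ 1 := by rw [div_le_one hDpos]; exact hmD.le
    exact ⟨by linarith, by linarith [div_nonneg hm0 hDpos.le]⟩
  obtain ⟨T, -, hTcard, hT⟩ := exists_rounding s D (p := fun _ => l) fun _ => hl01
  simp only [Finset.sum_const, nsmul_eq_mul] at hTcard
  have hTcard' : l * D.card - d ≤ T.card := by
    have := hT fun _ => 1
    simp only [Finset.sum_const, nsmul_eq_mul, mul_one, abs_one, Finset.card_univ] at this
    linarith [(abs_le.mp this).1]
  have hdiff : ∑ j, |(imbalance μ s T - l • imbalance μ s D) j| ≤ 2 * d := by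
    calc ∑ j, |(imbalance μ s T - l • imbalance μ s D) j|
        ≤ ∑ j, ∑ i, |(if i = j then 1 else 0) - μ j| := by
          refine Finset.sum_le_sum fun j _ => ?_
          have := hT fun i => (if i = j then 1 else 0) - μ j
          rw [← Finset.mul_sum] at this
          exact this
      _ ≤ ∑ j, ∑ i, ((if i = j then 1 else 0) + μ j) := by
          refine Finset.sum_le_sum fun j _ => Finset.sum_le_sum fun i _ => (abs_sub _ _).trans ?_
          rw [abs_of_nonneg (hμ0 j)]
          split_ifs <;> simp
      _ = 2 * d := by
          simp only [Finset.sum_add_distrib, Finset.sum_ite_eq', Finset.mem_univ, if_true,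
            Finset.sum_const, Finset.card_univ, nsmul_eq_mul, ← Finset.mul_sum, hμ]
          ring
  have hΦ : Φ.toFun (imbalance μ s T) ≤ A + 2 * d * Φ.C := by
    have h1 := Φ.add_le (l • imbalance μ s D) (imbalance μ s T - l • imbalance μ s D)
    rw [add_sub_cancel, Φ.smul, abs_of_nonneg hl01.1] at h1
    have h2 := (Φ.le_sum_abs (imbalance μ s T - l • imbalance μ s D)).trans
      (mul_le_mul_of_nonneg_left hdiff hC.le)
    have h3 : l * A ≤ A := mul_le_of_le_one_left hA hl01.2
    linarith
  have hadm : Admissible Φ μ θ s T := by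
    right
    have h1 : b ≤ N - T.card := by linarith
    have := mul_le_mul_of_nonneg_left h1 hθ.le
    linarith
  linarith [uncontrolled_le Φ μ θ hadm]

/-- The contraction of the number of uncontrolled bandits, given the deviation of a set. -/
lemma uncontrolled_le_contraction (hμ0 : ∀ j, 0 ≤ μ j) (hμ : ∑ j, μ j = 1) (hθ : 0 < θ)
    (s : Fin N → S) (D : Finset (Fin N)) {X : ℝ} (hX0 : 0 ≤ X)
    (hX : Φ.toFun (imbalance μ s D) ≤ Φ.ρ * (θ * (N - D.card)) + X) :
    uncontrolled Φ μ θ s ≤ (2 * Φ.C + Φ.ρ * θ) / (2 * Φ.C + θ) * (N - D.card) +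
      ((X + 2 * Fintype.card S * Φ.C + Fintype.card S) / θ + Fintype.card S + 1) := by
  set d : ℝ := (Fintype.card S : ℝ)
  have hd : 0 ≤ d := Nat.cast_nonneg _
  have hC := Φ.C_pos
  have hρ := Φ.ρ_nonneg
  have hρ1 := Φ.ρ_lt_one
  have hdC := mul_nonneg hd hC.le
  have hpos : 0 < 2 * Φ.C + θ := by linarith
  have hDN : (D.card : ℝ) ≤ N := by
    exact_mod_cast (Finset.card_le_univ _).trans_eq (Fintype.card_fin N)
  set u : ℝ := N - D.card
  have hu : 0 ≤ u := by simp only [u]; linarith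
  rcases le_total (Φ.toFun (imbalance μ s D) + d) (θ * u) with h | h
  · refine (uncontrolled_le_of_small Φ hμ0 hμ hθ s D h).trans ?_
    have h1 : (Φ.toFun (imbalance μ s D) + 2 * Φ.C * u + d) / (2 * Φ.C + θ) ≤
        (2 * Φ.C + Φ.ρ * θ) / (2 * Φ.C + θ) * u + (X + d) / (2 * Φ.C + θ) := by
      rw [div_mul_eq_mul_div, ← add_div]
      exact div_le_div_of_nonneg_right (by linarith) hpos.le
    have h2 : (X + d) / (2 * Φ.C + θ) ≤ (X + 2 * d * Φ.C + d) / θ := by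
      gcongr
      · linarith
      · linarith
    linarith
  · refine (uncontrolled_le_of_large Φ hμ0 hμ hθ s D h).trans ?_
    have h1 : (Φ.toFun (imbalance μ s D) + 2 * d * Φ.C + d) / θ ≤
        Φ.ρ * u + (X + 2 * d * Φ.C + d) / θ := by
      rw [show Φ.ρ * u = (Φ.ρ * (θ * u)) / θ by field_simp, ← add_div]
      exact div_le_div_of_nonneg_right (by linarith) hθ.le
    -- The growth case has the weaker contraction factor, so this factor serves both cases.
    have h2 : Φ.ρ ≤ (2 * Φ.C + Φ.ρ * θ) / (2 * Φ.C + θ) := by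
      rw [le_div_iff₀ hpos]
      nlinarith
    have h3 := mul_le_mul_of_nonneg_right h2 hu
    linarith

end Controlled

/-! ### The constrained policy, its drift, and the `√N` bound. -/

section Control

open Matrix

variable {S : Type*} [Fintype S] [DecidableEq S] {B : Bandit S} {α : ℝ} (m : B.OptimalMixture α)
  (Φ : ContractedNorm (B.mixP m.p)) {N : ℕ}

/-- Activating a prescribed number of bandits, one can follow the mixture up to rounding on an
admissible set. -/
theorem Bandit.OptimalMixture.exists_action {θ : ℝ} (hθ0 : 0 ≤ θ) (hθα : θ ≤ α) (hθα' : θ ≤ 1 - α)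
    {K : ℕ} (hK : α * N = K) {s : Fin N → S} {D : Finset (Fin N)}
    (hD : Admissible Φ m.μ θ s D) :
    ∃ a : Fin N → Fin 2, numActive a = α * N ∧ ∀ f : S → Fin 2 → ℝ,
      |∑ k ∈ D, (f (s k) (a k) - mix m.p f (s k))| ≤ ∑ i, |f i 1 - f i 0| := by
  have hKN : K ≤ N := by
    have : (K : ℝ) ≤ N := by rw [← hK]; exact mul_le_of_le_one_left (Nat.cast_nonneg N) (by linarith)
    exact_mod_cast this
  have hDN : D.card ≤ N := (Finset.card_le_univ _).trans_eq (Fintype.card_fin N)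
  have hDN' : (D.card : ℝ) ≤ N := by exact_mod_cast hDN
  obtain ⟨T, hTD, -, hT⟩ := exists_rounding s D m.p_mem
  have hcard : T.card ≤ K ∧ K ≤ T.card + (N - D.card) := by
    rcases hD with rfl | hD
    · rw [Finset.subset_empty.mp hTD]
      simp only [Finset.card_empty]
      omega
    -- The set `D` requests `α |D|` activations, up to its deviation and up to `d` for rounding. By
    -- admissibility the total error is at most `θ (N - |D|)`. As `θ ≤ α` and `θ ≤ 1 - α`, what
    -- remains of the budget lies between `0` and `N - |D|`.
    · have h1 := hT fun _ => 1
      simp only [Finset.sum_const, nsmul_eq_mul, mul_one, abs_one, Finset.card_univ] at h1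
      have h2 := sum_imbalance_mul m.μ s D m.p
      rw [m.active] at h2
      have h3 : |∑ j, imbalance m.μ s D j * m.p j| ≤ Φ.toFun (imbalance m.μ s D) := by
        refine ((Finset.abs_sum_le_sum_abs _ _).trans (Finset.sum_le_sum fun j _ => ?_)).trans
          (Φ.sum_abs_le _)
        rw [abs_mul, abs_of_nonneg (m.p_mem j).1]
        exact mul_le_of_le_one_right (abs_nonneg _) (m.p_mem j).2
      rw [h2] at h3
      rw [abs_le] at h1 h3
      have h4 : θ * (N - D.card) ≤ α * (N - D.card) :=
        mul_le_mul_of_nonneg_right hθα (by linarith)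
      have h5 : θ * (N - D.card) ≤ (1 - α) * (N - D.card) :=
        mul_le_mul_of_nonneg_right hθα' (by linarith)
      have h6 : (T.card : ℝ) ≤ K := by rw [← hK]; linarith
      have h7 : (K : ℝ) ≤ T.card + ((N - D.card : ℕ) : ℝ) := by
        rw [← hK, Nat.cast_sub hDN]; linarith
      exact ⟨by exact_mod_cast h6, by exact_mod_cast h7⟩
  have hdisj : Disjoint T Dᶜ := disjoint_compl_right.mono_left hTD
  obtain ⟨A, hTA, hAD, hA⟩ := Finset.exists_subsuperset_card_eq
    (Finset.subset_union_left (s₁ := T) (s₂ := Dᶜ)) (n := K) hcard.1 (by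
      rw [Finset.card_union_of_disjoint hdisj, Finset.card_compl, Fintype.card_fin]
      exact hcard.2)
  refine ⟨fun k => if k ∈ A then 1 else 0, ?_, fun f => ?_⟩
  · have : ∀ k : Fin N, (((if k ∈ A then 1 else 0 : Fin 2) : ℕ) : ℝ) = if k ∈ A then 1 else 0 :=
      fun k => by split_ifs <;> simp
    simp only [numActive, this, Finset.sum_ite_mem, Finset.univ_inter, Finset.sum_const,
      nsmul_eq_mul, mul_one, hA, hK]
  · have hAT : ∀ k ∈ D, (k ∈ A ↔ k ∈ T) := fun k hk =>
      ⟨fun h => (Finset.mem_union.mp (hAD h)).resolve_right (by simpa using hk), fun h => hTA h⟩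
    have h1 : ∑ k ∈ D, (f (s k) (if k ∈ A then 1 else 0) - mix m.p f (s k)) =
        ∑ k ∈ T, (f (s k) 1 - f (s k) 0) - ∑ k ∈ D, m.p (s k) * (f (s k) 1 - f (s k) 0) := by
      rw [← Finset.inter_eq_right.mpr hTD, ← Finset.sum_ite_mem, ← Finset.sum_sub_distrib]
      refine Finset.sum_congr rfl fun k hk => ?_
      simp only [hAT k hk, mix]
      split_ifs <;> ring
    rw [h1]
    exact hT fun i => f i 1 - f i 0

lemma Bandit.abs_P_sub_le_one (B : Bandit S) (a b : Fin 2) (i j k : S) :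
    |B.P a i k - B.P b j k| ≤ 1 := by
  have h : ∀ a i, B.P a i k ≤ 1 := fun a i => by
    rw [← B.P_sum a i]
    exact Finset.single_le_sum (fun j _ => B.P_nonneg a i j) (Finset.mem_univ k)
  rw [abs_le]
  constructor <;> linarith [h a i, h b j, B.P_nonneg a i k, B.P_nonneg b j k]

/-- The fluctuation of the number of bandits of `D` that move to the state `j`. -/
def Bandit.noise (B : Bandit S) (s : Fin N → S) (a : Fin N → Fin 2) (D : Finset (Fin N))
    (s' : Fin N → S) (j : S) : ℝ :=
  ∑ k ∈ D, ((if s' k = j then 1 else 0) - B.P (a k) (s k) j)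

lemma Bandit.sum_jointP_mul_noise_le (B : Bandit S) (s : Fin N → S) (a : Fin N → Fin 2)
    (D : Finset (Fin N)) :
    ∑ s', B.jointP s a s' * ∑ j, |B.noise s a D s' j| ≤ Fintype.card S * √(N : ℝ) := by
  simp only [Finset.mul_sum]
  rw [Finset.sum_comm]
  refine (Finset.sum_le_sum (g := fun _ => √(N : ℝ)) fun j _ => ?_).trans_eq (by simp)
  have := sum_prod_weights_mul_abs_sum_le (w := fun n i => B.P (a n) (s n) i)
    (fun n i => B.P_nonneg _ _ _) (fun n => B.P_sum _ _) D
    (f := fun n i => (if i = j then 1 else 0) - B.P (a n) (s n) j)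
    (fun n => by simp [mul_sub, Finset.sum_sub_distrib, ← Finset.sum_mul, B.P_sum])
    (fun n i => by
      have h1 : B.P (a n) (s n) j ≤ 1 := by
        rw [← B.P_sum (a n) (s n)]
        exact Finset.single_le_sum (fun j _ => B.P_nonneg _ _ j) (Finset.mem_univ j)
      have h0 := B.P_nonneg (a n) (s n) j
      rw [abs_le]
      split_ifs <;> constructor <;> linarith)
  rwa [Fintype.card_fin] at this

/-- One step of the deviation of a set of bandits that follow the mixture up to rounding. -/
lemma Bandit.OptimalMixture.norm_imbalance_step_le (s : Fin N → S) (a : Fin N → Fin 2)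
    (D : Finset (Fin N))
    (ha : ∀ f : S → Fin 2 → ℝ,
      |∑ k ∈ D, (f (s k) (a k) - mix m.p f (s k))| ≤ ∑ i, |f i 1 - f i 0|) (s' : Fin N → S) :
    Φ.toFun (imbalance m.μ s' D) ≤ Φ.ρ * Φ.toFun (imbalance m.μ s D) +
      Φ.C * (Fintype.card S * Fintype.card S + ∑ j, |B.noise s a D s' j|) := by
  let e : S → ℝ := fun j =>
    ∑ k ∈ D, (B.P (a k) (s k) j - mix m.p (fun i a => B.P a i j) (s k))
  have he : ∀ j, |e j| ≤ Fintype.card S := fun j => by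
    refine (ha fun i a => B.P a i j).trans ((Finset.sum_le_sum fun i _ =>
      B.abs_P_sub_le_one 1 0 i i j).trans_eq (by simp))
  -- The new deviation is the old one transported by the mixture (`μ` is stationary), plus the
  -- rounding error `e`, plus the centred sampling noise.
  have hdec : imbalance m.μ s' D = imbalance m.μ s D ᵥ* B.mixP m.p + (e + B.noise s a D s') := by
    funext j
    have h1 : (imbalance m.μ s D ᵥ* B.mixP m.p) j =
        ∑ k ∈ D, B.mixP m.p (s k) j - D.card * m.μ j := by
      refine (sum_imbalance_mul m.μ s D fun i => B.mixP m.p i j).trans ?_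
      congr 2
      exact congrFun m.stationary j
    have h2 : ∀ i, mix m.p (fun i a => B.P a i j) i = B.mixP m.p i j := fun i => rfl
    simp only [Pi.add_apply, h1, e, Bandit.noise, h2, imbalance, Finset.sum_sub_distrib,
      Finset.sum_const, nsmul_eq_mul]
    ring
  rw [hdec]
  refine (Φ.add_le _ _).trans (add_le_add (Φ.vecMul_le _ (sum_imbalance m.μ_sum s D)) ?_)
  refine (Φ.le_sum_abs _).trans (mul_le_mul_of_nonneg_left ?_ Φ.C_pos.le)
  calc ∑ j, |(e + B.noise s a D s') j| ≤ ∑ j, (Fintype.card S + |B.noise s a D s' j|) :=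
        Finset.sum_le_sum fun j _ => (abs_add_le _ _).trans (by linarith [he j])
    _ = _ := by rw [Finset.sum_add_distrib]; simp

/-- The number of uncontrolled bandits contracts in the mean, up to fluctuations of order `√N`. -/
theorem Bandit.OptimalMixture.exists_uncontrolled_drift {θ : ℝ} (hθ : 0 < θ) :
    ∃ κ c : ℝ, κ < 1 ∧ ∀ (N : ℕ), 1 ≤ N → ∀ (s : Fin N → S) (a : Fin N → Fin 2),
      (∀ f : S → Fin 2 → ℝ, |∑ k ∈ controlled Φ m.μ θ s, (f (s k) (a k) - mix m.p f (s k))| ≤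
        ∑ i, |f i 1 - f i 0|) →
      ∑ s', B.jointP s a s' * uncontrolled Φ m.μ θ s' ≤
        κ * uncontrolled Φ m.μ θ s + c * √(N : ℝ) := by
  set d : ℝ := (Fintype.card S : ℝ)
  have hd : 0 ≤ d := Nat.cast_nonneg _
  have hC := Φ.C_pos
  have hpos : 0 < 2 * Φ.C + θ := by linarith
  set κ := (2 * Φ.C + Φ.ρ * θ) / (2 * Φ.C + θ)
  set c₀ := (Φ.C * (d * d) + 2 * d * Φ.C + d) / θ + d + 1 with hc₀
  have hc₀0 : 0 ≤ c₀ := by positivity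
  refine ⟨κ, c₀ + Φ.C * d / θ, ?_, fun N hN s a ha => ?_⟩
  · rw [div_lt_one hpos]
    nlinarith [Φ.ρ_lt_one]
  set D := controlled Φ m.μ θ s
  have hstep : ∀ s', uncontrolled Φ m.μ θ s' ≤
      (κ * uncontrolled Φ m.μ θ s + c₀) + Φ.C / θ * ∑ j, |B.noise s a D s' j| := by
    intro s'
    have hn : 0 ≤ ∑ j, |B.noise s a D s' j| := Finset.sum_nonneg fun _ _ => abs_nonneg _
    have h1 := m.norm_imbalance_step_le Φ s a D ha s'
    have h2 := mul_le_mul_of_nonneg_left (norm_imbalance_controlled_le Φ (μ := m.μ) hθ.le s)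
      Φ.ρ_nonneg
    have h3 := uncontrolled_le_contraction Φ m.μ_nonneg m.μ_sum hθ s' D
      (X := Φ.C * (d * d + ∑ j, |B.noise s a D s' j|)) (by positivity)
      (h1.trans (add_le_add h2 le_rfl))
    refine h3.trans_eq ?_
    change κ * uncontrolled Φ m.μ θ s + _ = _
    rw [hc₀]
    ring
  have hsqrt : 1 ≤ √(N : ℝ) := by rw [Real.one_le_sqrt]; exact_mod_cast hN
  calc ∑ s', B.jointP s a s' * uncontrolled Φ m.μ θ s'
      ≤ ∑ s', B.jointP s a s' * ((κ * uncontrolled Φ m.μ θ s + c₀) +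
          Φ.C / θ * ∑ j, |B.noise s a D s' j|) :=
        Finset.sum_le_sum fun s' _ =>
          mul_le_mul_of_nonneg_left (hstep s') (B.jointP_nonneg s a s')
    _ = (κ * uncontrolled Φ m.μ θ s + c₀) +
          Φ.C / θ * ∑ s', B.jointP s a s' * ∑ j, |B.noise s a D s' j| := by
        simp only [mul_add, Finset.sum_add_distrib, ← Finset.sum_mul, B.sum_jointP, one_mul]
        congr 1
        rw [Finset.mul_sum]
        exact Finset.sum_congr rfl fun s' _ => by ring
    _ ≤ (κ * uncontrolled Φ m.μ θ s + c₀ * √(N : ℝ)) + Φ.C / θ * (d * √(N : ℝ)) := by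
        gcongr
        · exact le_mul_of_one_le_right hc₀0 hsqrt
        · exact B.sum_jointP_mul_noise_le s a D
    _ = κ * uncontrolled Φ m.μ θ s + (c₀ + Φ.C * d / θ) * √(N : ℝ) := by ring

/-- The loss in one step, in terms of a solution `h` of the Poisson equation, is at most
proportional to the number of bandits that do not follow the mixture. -/
lemma sum_sub_ge_of_follow {p h : S → ℝ} {V : ℝ} {F : S → Fin 2 → ℝ}
    (hF : ∀ i, mix p F i = V + h i) (s : Fin N → S) (a : Fin N → Fin 2) (D : Finset (Fin N))
    (ha : |∑ k ∈ D, (F (s k) (a k) - mix p F (s k))| ≤ ∑ i, |F i 1 - F i 0|) :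
    -(∑ i, |F i 1 - F i 0|) - (∑ i, ∑ b, |F i b - V - h i|) * (N - D.card) ≤
      ∑ n, F (s n) (a n) - (N * V + ∑ n, h (s n)) := by
  have h1 : ∑ n, F (s n) (a n) - (N * V + ∑ n, h (s n)) =
      ∑ n, (F (s n) (a n) - V - h (s n)) := by
    simp only [Finset.sum_sub_distrib, Finset.sum_const, Finset.card_univ, Fintype.card_fin,
      nsmul_eq_mul]
    ring
  have h2 : ∑ k ∈ D, (F (s k) (a k) - mix p F (s k)) =
      ∑ k ∈ D, (F (s k) (a k) - V - h (s k)) :=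
    Finset.sum_congr rfl fun k _ => by rw [hF]; ring
  have hcard : ((Dᶜ.card : ℕ) : ℝ) = N - D.card := by
    rw [Finset.card_compl, Fintype.card_fin, Nat.cast_sub]
    exact (Finset.card_le_univ _).trans_eq (Fintype.card_fin N)
  have h3 : -((∑ i, ∑ b, |F i b - V - h i|) * (N - D.card)) ≤
      ∑ n ∈ Dᶜ, (F (s n) (a n) - V - h (s n)) := by
    rw [← hcard, mul_comm, ← mul_neg, ← nsmul_eq_mul]
    refine Finset.card_nsmul_le_sum _ _ _ fun n _ => (neg_le_neg ?_).trans (neg_abs_le _)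
    calc |F (s n) (a n) - V - h (s n)| ≤ ∑ b, |F (s n) b - V - h (s n)| :=
          Finset.single_le_sum (f := fun b => |F (s n) b - V - h (s n)|)
            (fun _ _ => abs_nonneg _) (Finset.mem_univ _)
      _ ≤ _ := Finset.single_le_sum (f := fun i => ∑ b, |F i b - V - h i|)
            (fun _ _ => Finset.sum_nonneg fun _ _ => abs_nonneg _) (Finset.mem_univ _)
  rw [h2] at ha
  rw [h1, ← Finset.sum_add_sum_compl D]
  linarith [(abs_le.mp ha).1]

/-- A hard-feasible policy that loses at most `O(√N)` against the relaxation. -/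
theorem Bandit.OptimalMixture.exists_policy_ge (hB : B.IsAperiodicUnichain) (hα0 : 0 < α)
    (hα1 : α < 1) : ∃ c : ℝ, ∀ N : ℕ, 1 ≤ N → (∃ K : ℕ, α * N = K) → ∀ s₀ : Fin N → S,
      ∃ (π : Policy S N) (v : ℝ), (∀ s a, 0 < π.prob s a → numActive a = α * N) ∧
        B.HasAverage π s₀ B.reward v ∧ N * m.value - c * √(N : ℝ) ≤ v := by
  obtain ⟨K₀, j₀, hK₀⟩ := hB.exists_mixP_pow_pos m.p_mem
  have hM := B.mixP_mem_rowStochastic m.p_mem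
  obtain ⟨Φ⟩ := nonempty_contractedNorm hM hK₀
  obtain ⟨h, hh⟩ := exists_poisson hM hK₀ m.stationary m.μ_sum (mix m.p fun i a => B.R a i)
  let θ := min α (1 - α)
  have hθ : 0 < θ := lt_min hα0 (by linarith)
  obtain ⟨κ, c₃, hκ, hdrift⟩ := m.exists_uncontrolled_drift Φ hθ
  let F : S → Fin 2 → ℝ := fun i a => B.R a i + (B.P a *ᵥ h) i
  have hF : ∀ i, mix m.p F i = m.value + h i := by
    intro i
    have h1 : mix m.p F i = mix m.p (fun i a => B.R a i) i + (B.mixP m.p *ᵥ h) i := by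
      rw [B.mixP_mulVec]; simp only [mix, F]; ring
    rw [h1, hh i, Bandit.OptimalMixture.value]
    ring
  set c₁ := ∑ i, |F i 1 - F i 0|
  set c₂ := ∑ i, ∑ b, |F i b - m.value - h i|
  have hc₁ : 0 ≤ c₁ := Finset.sum_nonneg fun _ _ => abs_nonneg _
  have hc₂ : 0 ≤ c₂ := Finset.sum_nonneg fun _ _ => Finset.sum_nonneg fun _ _ => abs_nonneg _
  -- Chosen so that the mean decrease `c₄ (1 - κ) U` pays exactly for the loss `c₂ U`.
  set c₄ := c₂ / (1 - κ)
  have hc₄ : c₄ * (1 - κ) = c₂ := div_mul_cancel₀ _ (by linarith)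
  have hc₄0 : 0 ≤ c₄ := div_nonneg hc₂ (by linarith)
  refine ⟨c₁ + c₄ * c₃, fun N hN ⟨K, hK⟩ s₀ => ?_⟩
  choose a ha_num ha using fun s : Fin N → S =>
    m.exists_action Φ hθ.le (min_le_left _ _) (min_le_right _ _) hK
      (admissible_controlled Φ m.μ θ s)
  obtain ⟨v, hv⟩ := B.exists_hasAverage (detPolicy a) s₀ B.reward
  refine ⟨detPolicy a, v, fun s b hb => ?_, hv, ?_⟩
  · simp only [detPolicy] at hb
    split_ifs at hb with hba
    · rw [hba, ha_num]
    · exact absurd hb (lt_irrefl _)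
  have hsqrt : 1 ≤ √(N : ℝ) := by rw [Real.one_le_sqrt]; exact_mod_cast hN
  -- The Poisson part of this potential accounts for the reward of the ideal mixture, the second
  -- part for the bandits that do not follow it.
  refine hv.ge_of_drift (G := fun s => ∑ n, h (s n) - c₄ * uncontrolled Φ m.μ θ s) fun s => ?_
  rw [B.kernel_mulVec, detPolicy_mean, detPolicy_mean]
  have h1 : ∑ s', B.jointP s (a s) s' * (∑ n, h (s' n) - c₄ * uncontrolled Φ m.μ θ s') =
      ∑ n, (B.P (a s n) *ᵥ h) (s n) -
        c₄ * ∑ s', B.jointP s (a s) s' * uncontrolled Φ m.μ θ s' := by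
    rw [← B.sum_jointP_mul_sum s (a s) Finset.univ fun _ => h, Finset.mul_sum,
      ← Finset.sum_sub_distrib]
    exact Finset.sum_congr rfl fun s' _ => by ring
  have h2 := mul_le_mul_of_nonneg_left (hdrift N hN s (a s) (ha s)) hc₄0
  have h3 := sum_sub_ge_of_follow hF s (a s) _ (ha s F)
  have h4 : ∑ n, F (s n) (a s n) = B.reward s (a s) + ∑ n, (B.P (a s n) *ᵥ h) (s n) := by
    simp only [F, Bandit.reward, Finset.sum_add_distrib]
  rw [h4] at h3
  change -c₁ - c₂ * uncontrolled Φ m.μ θ s ≤ _ at h3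
  rw [h1]
  have h5 : c₁ ≤ c₁ * √(N : ℝ) := le_mul_of_one_le_right hc₁ hsqrt
  rw [← hc₄] at h3
  linarith

/-- The gap between the optimal and the relaxed value is `O(√N)`. -/
theorem Bandit.OptimalMixture.exists_abs_optValue_sub_le (hB : B.IsAperiodicUnichain)
    (hα0 : 0 ≤ α) (hα1 : α ≤ 1) : ∃ c : ℝ, ∀ N : ℕ, 1 ≤ N → (∃ K : ℕ, α * N = K) →
      ∀ s₀ : Fin N → S, |B.optValue α N s₀ - N * m.value| ≤ c * √(N : ℝ) := by
  by_cases hα : α = 0 ∨ α = 1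
  · refine ⟨0, fun N hN _ s₀ => ?_⟩
    refine m.abs_optValue_sub_le hN (π := indepPolicy m.p m.p_mem N) (fun s a hpos => ?_)
      (m.hasAverage_reward hB s₀) (by simp)
    -- With `p` identically `0` or `1`, only the constant action vector has positive probability.
    have hone : ∀ n, (((a n : Fin 2) : ℕ) : ℝ) = α := by
      intro n
      have hn : ![1 - m.p (s n), m.p (s n)] (a n) ≠ 0 := fun h0 =>
        hpos.ne' (Finset.prod_eq_zero (Finset.mem_univ n) h0)
      rw [m.p_eq hα] at hn
      generalize a n = b at hn ⊢
      rcases hα with rfl | rfl <;> fin_cases b <;> simp_all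
    simp [numActive, hone, mul_comm]
  · push Not at hα
    obtain ⟨c, hc⟩ := m.exists_policy_ge hB (lt_of_le_of_ne hα0 hα.1.symm)
      (lt_of_le_of_ne hα1 hα.2)
    refine ⟨c, fun N hN hK s₀ => ?_⟩
    obtain ⟨π, v, hπ, hv, hle⟩ := hc N hN hK s₀
    exact m.abs_optValue_sub_le hN hπ hv hle

end Control

end RestlessBandit

/-- The single-bandit relaxed value is taken from an arbitrary initial state `s₁`, and the
`N`-bandit values from arbitrary initial states `s₀ N`. -/
theorem theorem1 {S : Type*} [Fintype S] [DecidableEq S] (B : RestlessBandit.Bandit S)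
    (hB : B.IsAperiodicUnichain) (hrat : B.IsRational)
    (α : ℝ) (hα0 : 0 ≤ α) (hα1 : α ≤ 1)
    (s₁ : Fin 1 → S) (s₀ : ∀ N : ℕ, Fin N → S) :
    (∀ N : ℕ, 1 ≤ N → B.relValue α N (s₀ N) = N * B.relValue α 1 s₁) ∧
    Tendsto (fun N : ℕ => B.optValue α N (s₀ N) / N) (RestlessBandit.atTopIntegral α)
      (𝓝 (B.relValue α 1 s₁)) ∧
    limsup (fun N : ℕ =>
        ((√(N : ℝ) * |B.optValue α N (s₀ N) / N - B.relValue α 1 s₁| : ℝ) : EReal))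
      (RestlessBandit.atTopIntegral α) < ⊤ := by
  have : Nonempty S := ⟨s₁ 0⟩
  obtain ⟨m⟩ := B.nonempty_optimalMixture hα0 hα1
  have h1 : B.relValue α 1 s₁ = m.value := by
    rw [m.relValue_eq hB le_rfl s₁, Nat.cast_one, one_mul]
  rw [h1]
  obtain ⟨c, hc⟩ := m.exists_abs_optValue_sub_le hB hα0 hα1
  have hev : ∀ᶠ N : ℕ in RestlessBandit.atTopIntegral α,
      1 ≤ N ∧ |B.optValue α N (s₀ N) / N - m.value| ≤ c / √(N : ℝ) := by
    rw [RestlessBandit.atTopIntegral, eventually_inf_principal]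
    filter_upwards [eventually_ge_atTop 1] with N hN hK
    refine ⟨hN, ?_⟩
    have hN' : (0 : ℝ) < N := by exact_mod_cast hN
    have hs : 0 < √(N : ℝ) := Real.sqrt_pos.mpr hN'
    have hgap := hc N hN hK (s₀ N)
    have heq : B.optValue α N (s₀ N) / N - m.value =
        (B.optValue α N (s₀ N) - N * m.value) / N := by field_simp
    rw [heq, abs_div, abs_of_pos hN', div_le_div_iff₀ hN' hs]
    calc _ ≤ c * √(N : ℝ) * √(N : ℝ) := mul_le_mul_of_nonneg_right hgap hs.le
      _ = c * N := by rw [mul_assoc, Real.mul_self_sqrt hN'.le]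
  refine ⟨fun N hN => m.relValue_eq hB hN (s₀ N), ?_, ?_⟩
  · rw [tendsto_iff_dist_tendsto_zero]
    have hlim : Tendsto (fun N : ℕ => c / √(N : ℝ)) (RestlessBandit.atTopIntegral α) (𝓝 0) :=
      ((tendsto_const_nhds (x := c)).div_atTop
        (Real.tendsto_sqrt_atTop.comp tendsto_natCast_atTop_atTop)).mono_left inf_le_left
    exact squeeze_zero' (Eventually.of_forall fun _ => dist_nonneg) (hev.mono fun N h => h.2) hlim
  -- An eventual upper bound suffices in `EReal`, even when the filter is trivial, as it is for
  -- irrational `α`.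
  · refine lt_of_le_of_lt (limsup_le_of_le (a := ((c : ℝ) : EReal)) (by isBoundedDefault) ?_)
      (EReal.coe_lt_top c)
    filter_upwards [hev] with N ⟨hN, h⟩
    have hs : 0 < √(N : ℝ) := Real.sqrt_pos.mpr (by exact_mod_cast hN)
    rw [EReal.coe_le_coe_iff]
    rw [le_div_iff₀ hs] at h
    linarith
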